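/- Let $3\le d\le p$ be integers. A planar map is a finite connected graph (loops and multiple edges allowed) embedded in the oriented sphere. A $p$-annular $d$-angulation is a planar map with a marked boundary face of degree $p$ whose contour is simple (its vertices are all distinct), and with a marked root-face different from the boundary face, all faces other than the boundary face having degree $d$. The vertices and edges incident to the root-face are called outer, and the vertices incident to the boundary face are called boundary vertices. The girth of a map is the minimal length of its cycles. An $\mathbb{N}$-biorientation of a map is an assignment of a weight in $\mathbb{N}=\{0,1,2,\dots\}$ to each half-edge; a half-edge is ingoing (directed toward its vertex) if its weight is positive, and outgoing (directed toward the middle of its edge) if its weight is $0$. An edge is $i$-way if exactly $i$ of its half-edges are ingoing; a 1-way edge is directed toward its end that carries the ingoing half-edge. The weight of an edge is the sum of the weights of its two half-edges, and the weight of a vertex is the sum of the weights of the ingoing half-edges at it. A directed path follows each of its edges either along a 2-way edge or along a 1-way edge in its direction. A circuit is a simple directed cycle (no vertex or edge used twice); it is clockwise if the root-face is on its left, and counterclockwise otherwise. The biorientation is minimal if it has no counterclockwise circuit. It is clockwise-minimal if it is minimal and each outer edge is either 2-way, or 1-way with a face other than the root-face on its right. It is accessible if there is an outer vertex from which every vertex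 can be reached by a directed path. Let $\mathcal{B}$ be the class of clockwise-minimal accessible biorientations. A pseudo $d/(d-2)$-orientation of a $p$-annular $d$-angulation is an $\mathbb{N}$-biorientation in which every edge has weight $d-2$, every non-boundary vertex has weight $d$, and the contour of the boundary face is a clockwise circuit of 1-way edges (that is, these edges are 1-way with the boundary face on their right). A simple cycle of a $p$-annular $d$-angulation is separating if the boundary face and the root-face are on different sides of it and it is not equal to the contour of the root-face. The $p$-annular $d$-angulation is non-separated if it has no separating cycle of length $d$. Proposition. Let $A$ be a $p$-annular $d$-angulation of girth $d$. Then $A$ has a unique minimal pseudo $d/(d-2)$-orientation, and this orientation is clockwise-minimal and accessible (i.e., lies in $\mathcal{B}$) if and only if $A$ is non-separated. -/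

import Mathlib

/-- A finite planar map with at least one edge, encoded by its half-edges.  The elements of `D` are
the half-edges (darts); a dart `x` is also read as its edge, traversed from the vertex carrying `x`
to the vertex carrying the opposite half-edge.  `rot x` is the half-edge following `x` in
counterclockwise order around its vertex, and `opp x` is the other half of the edge of `x`.
The underlying graph is connected; loops and multiple edges are allowed.  Vertices, edges and faces
are the cycles of `rot`, `opp` and `rot⁻¹ * opp`; the Euler relation says that the surface is the
sphere. -/
structure PlanarMap (D : Type*) where
  rot : Equiv.Perm D
  opp : Equiv.Perm D
  opp_opp : ∀ x, opp (opp x) = x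
  opp_ne : ∀ x, opp x ≠ x
  connected : ∀ x y, ∃ g ∈ Subgroup.closure {rot, opp}, g x = y
  euler : (Nat.card (Quotient (Equiv.Perm.SameCycle.setoid rot)) : ℤ)
      - Nat.card (Quotient (Equiv.Perm.SameCycle.setoid opp))
      + Nat.card (Quotient (Equiv.Perm.SameCycle.setoid (rot⁻¹ * opp))) = 2

namespace PlanarMap

variable {D : Type*} (M : PlanarMap D)

/-- The permutation turning around the faces: following `x` and keeping its left face on the left,
the next dart is `facePerm x`. -/
def facePerm : Equiv.Perm D := M.rot⁻¹ * M.opp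

/-- The vertices of the map. -/
def Vertex : Type _ := Quotient (Equiv.Perm.SameCycle.setoid M.rot)

/-- The edges of the map. -/
def Edge : Type _ := Quotient (Equiv.Perm.SameCycle.setoid M.opp)

/-- The faces of the map. -/
def Face : Type _ := Quotient (Equiv.Perm.SameCycle.setoid M.facePerm)

/-- The vertex carrying the half-edge `x`, i.e. the origin of the dart `x`. -/
def tail (x : D) : M.Vertex := Quotient.mk (Equiv.Perm.SameCycle.setoid M.rot) x

/-- The end of the dart `x`. -/
def head (x : D) : M.Vertex := M.tail (M.opp x)

/-- The edge of which `x` is a half. -/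
def edge (x : D) : M.Edge := Quotient.mk (Equiv.Perm.SameCycle.setoid M.opp) x

/-- The face on the left of the dart `x`. -/
def left (x : D) : M.Face := Quotient.mk (Equiv.Perm.SameCycle.setoid M.facePerm) x

/-- The face on the right of the dart `x`. -/
def right (x : D) : M.Face := M.left (M.opp x)

/-- The degree of a face: its number of corners (each dart `x` gives the corner of the face
`left x` between `x` and `rot x`). -/
noncomputable def faceDegree (f : M.Face) : ℕ := Nat.card {x : D // M.left x = f}

/-- A vertex incident to the face `f`. -/
def VertexOnFace (f : M.Face) (v : M.Vertex) : Prop := ∃ x, M.left x = f ∧ M.tail x = v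

/-- The set of edges incident to the face `f` (the edges of its contour). -/
def contourEdges (f : M.Face) : Set M.Edge := {e | ∃ x, M.left x = f ∧ M.edge x = e}

/-- A simple cycle, as the list of its successive darts: it is closed and uses no vertex and no edge
twice. -/
def IsSimpleCycle (c : List D) : Prop :=
  c ≠ [] ∧ (c : Cycle D).Chain (fun x y => M.head x = M.tail y) ∧
    (c.map M.tail).Nodup ∧ (c.map M.edge).Nodup

/-- The set of edges of a list of darts. -/
def edgesOf (c : List D) : Set M.Edge := {e | ∃ x ∈ c, M.edge x = e}

/-- The map has girth `g`: its shortest cycle has length `g`. -/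
def HasGirth (g : ℕ) : Prop := IsLeast {n | ∃ c, M.IsSimpleCycle c ∧ c.length = n} g

/-- The faces `f` and `f'` lie in the same component of the complement of the edge set `C` (and of
the ends of these edges): one can go from `f` to `f'` by crossing only edges outside `C`. -/
def SameSide (C : Set M.Edge) (f f' : M.Face) : Prop :=
  Relation.ReflTransGen (fun g g' => ∃ x, M.edge x ∉ C ∧ M.left x = g ∧ M.right x = g') f f'

/-- The face `f` lies on the left side of the simple cycle `c`. -/
def OnLeftSide (c : List D) (f : M.Face) : Prop :=
  ∃ x ∈ c, M.SameSide (M.edgesOf c) (M.left x) f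

/-- A biorientation: a choice of a direction, ingoing or outgoing, for each half-edge.  The field is
the set of ingoing half-edges. -/
structure Biorientation (M : PlanarMap D) where
  ingoing : Set D

namespace Biorientation

variable {M} (O : M.Biorientation)

/-- The edge of the dart `x` is 2-way. -/
def TwoWay (x : D) : Prop := x ∈ O.ingoing ∧ M.opp x ∈ O.ingoing

/-- The edge of the dart `x` is 1-way and directed along `x`. -/
def OneWayAlong (x : D) : Prop := x ∉ O.ingoing ∧ M.opp x ∈ O.ingoing

/-- The dart `x` can be followed by a directed path: its edge is 2-way, or 1-way directed along
`x`. -/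
def Allowed (x : D) : Prop := O.TwoWay x ∨ O.OneWayAlong x

/-- There is a directed path from `u` to `v`. -/
def Reach (u v : M.Vertex) : Prop :=
  Relation.ReflTransGen (fun a b => ∃ x, O.Allowed x ∧ M.tail x = a ∧ M.head x = b) u v

/-- Every vertex is reachable from `u` by a directed path. -/
def AccessibleFrom (u : M.Vertex) : Prop := ∀ v, O.Reach u v

/-- A circuit: a simple directed cycle. -/
def IsCircuit (c : List D) : Prop := M.IsSimpleCycle c ∧ ∀ x ∈ c, O.Allowed x

/-- With root-face `root`, a circuit is clockwise if `root` is on its left, and counterclockwise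
otherwise; the biorientation is minimal if it has no counterclockwise circuit. -/
def IsMinimal (root : M.Face) : Prop := ∀ c, O.IsCircuit c → M.OnLeftSide c root

/-- Minimal, and each outer edge is 2-way or is 1-way with a non-root face on its right. -/
def IsClockwiseMinimal (root : M.Face) : Prop :=
  O.IsMinimal root ∧ ∀ x, M.edge x ∈ M.contourEdges root →
    O.TwoWay x ∨ ∃ y, M.edge y = M.edge x ∧ O.OneWayAlong y ∧ M.right y ≠ root

/-- Accessible from one of the outer vertices. -/
def IsAccessible (root : M.Face) : Prop := ∃ v, M.VertexOnFace root v ∧ O.AccessibleFrom v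

/-- The class `𝓑` of clockwise-minimal accessible biorientations (the defining conditions do not
involve the weights). -/
def InClassB (root : M.Face) : Prop := O.IsClockwiseMinimal root ∧ O.IsAccessible root

end Biorientation

/-- An `ℕ`-biorientation: ingoing half-edges have positive integer weight and outgoing ones have
weight `0`, so that it is determined by its weights. -/
@[ext] structure NBiorientation (M : PlanarMap D) where
  weight : D → ℕ

namespace NBiorientation

variable {M} (O : M.NBiorientation)

/-- The underlying biorientation: a half-edge is ingoing if its weight is positive. -/
def toBiorientation : M.Biorientation := ⟨{x | 0 < O.weight x}⟩

/-- The weight of the edge of the dart `x`. -/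
def edgeWeight (x : D) : ℕ := O.weight x + O.weight (M.opp x)

open Classical in
/-- The weight of a vertex: the sum of the weights of its ingoing half-edges. -/
noncomputable def vertexWeight [Fintype D] (v : M.Vertex) : ℕ :=
  ∑ x : D with M.tail x = v ∧ x ∈ O.toBiorientation.ingoing, O.weight x

end NBiorientation

end PlanarMap

/-- A `p`-annular `d`-angulation: a planar map with a marked boundary face of degree `p` whose
contour is simple (its vertices are all distinct), and a root-face different from the boundary
face, all the faces other than the boundary face having degree `d`. -/
structure AnnularAngulation (D : Type*) (p d : ℕ) extends PlanarMap D where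
  boundary : toPlanarMap.Face
  root : toPlanarMap.Face
  root_ne : root ≠ boundary
  boundary_degree : toPlanarMap.faceDegree boundary = p
  boundary_simple : ∀ x y, toPlanarMap.left x = boundary → toPlanarMap.left y = boundary →
    toPlanarMap.tail x = toPlanarMap.tail y → x = y
  inner_degree : ∀ f, f ≠ boundary → toPlanarMap.faceDegree f = d

namespace AnnularAngulation

variable {D : Type*} {p d : ℕ} (A : AnnularAngulation D p d)

/-- A separating cycle: a simple cycle having the boundary face and the root-face on different
sides, and different from the contour of the root-face. -/
def IsSeparating (c : List D) : Prop :=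
  A.IsSimpleCycle c ∧ ¬ A.SameSide (A.edgesOf c) A.boundary A.root ∧
    A.edgesOf c ≠ A.contourEdges A.root

/-- No separating cycle has length `d`. -/
def NonSeparated : Prop := ¬ ∃ c, A.IsSeparating c ∧ c.length = d

/-- A pseudo `d/(d-2)`-orientation: edges have weight `d - 2`, non-boundary vertices have weight
`d`, and the boundary face is a clockwise circuit of 1-way edges, i.e. each of its edges is 1-way
with the boundary face on its right. -/
def IsPseudoOrientation [Fintype D] (O : A.NBiorientation) : Prop :=
  (∀ x, O.edgeWeight x = d - 2) ∧
  (∀ v, ¬ A.VertexOnFace A.boundary v → O.vertexWeight v = d) ∧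
  (∀ x, A.right x = A.boundary → O.toBiorientation.OneWayAlong x)

/-- A pseudo `d/(d-2)`-orientation without counterclockwise circuit. -/
def IsMinimalPseudoOrientation [Fintype D] (O : A.NBiorientation) : Prop :=
  A.IsPseudoOrientation O ∧ O.toBiorientation.IsMinimal A.root

end AnnularAngulation

/-! Everything rests on two consequences of planarity. First, a divergence-free flow on the sphere
is the gradient of a function on faces (`exists_grad_eq`), because Euler's relation makes the two
dimensions agree. Secondly, applied to flows carried by a set `H` of edges, this gives Euler's
inequality for a submap (`card_add_two_le`). As girth `d` forces each region of a submap with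
several regions to have at least `d` sides, submaps are sparse: about `(d - 2) * |H| ≤ d * |W|`,
with sharper forms near the boundary face.

Existence is a matching problem: each inner edge distributes `d - 2` units to its ends, each inner
vertex receives `d`, and the boundary vertices share `p - d`. Sparsity is Hall's condition, and
Euler's relation says that the totals agree. Adding the gradient of a face function preserves edge
weights and inner vertex weights. A potential of maximal sum yields a minimal orientation, since a
counterclockwise circuit would allow raising the potential on its left. Conversely, two minimal
orientations differ by a gradient away from the boundary edges; a superlevel set above the value at
the root-face would be bordered by a counterclockwise circuit, so the gradient vanishes.

For the equivalence, let a `d`-cycle separate the root-face from the boundary face. Counting on the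
root side is then tight: the inner vertices there absorb all the edge weight, so no directed path
from that side enters the cycle, which is incompatible with membership in `𝓑` unless the cycle is
the root contour. Conversely, let `W` be the set of vertices unreachable from an outer vertex. The
weight at `W` comes only from edges inside `W`. Sparsity then forces `W` to contain the boundary,
and the region of the root-face to be bordered by a separating `d`-cycle. Without such cycles every
outer vertex reaches everything, and an outer edge directed the wrong way would close up into a
counterclockwise circuit. -/

open scoped Classical

set_option linter.unusedSectionVars false

/-! ### Incidence relations, connectedness of the dual, regions. -/

namespace PlanarMap

section Basic

variable {D : Type*} (M : PlanarMap D)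

theorem tail_eq_tail_iff {x y : D} : M.tail x = M.tail y ↔ M.rot.SameCycle x y :=
  Quotient.eq (r := Equiv.Perm.SameCycle.setoid M.rot)

theorem left_eq_left_iff {x y : D} : M.left x = M.left y ↔ M.facePerm.SameCycle x y :=
  Quotient.eq (r := Equiv.Perm.SameCycle.setoid M.facePerm)

theorem edge_eq_edge_iff {x y : D} : M.edge x = M.edge y ↔ y = x ∨ y = M.opp x := by
  refine (Quotient.eq (r := Equiv.Perm.SameCycle.setoid M.opp)).trans ⟨?_, ?_⟩
  · rintro ⟨i, rfl⟩
    have h2 : M.opp ^ (2 : ℤ) = 1 := by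
      rw [zpow_two]
      ext z
      simp [M.opp_opp]
    rcases Int.even_or_odd' i with ⟨k, rfl | rfl⟩
    · left
      simp [zpow_mul, h2]
    · right
      simp [zpow_add, zpow_mul, h2]
  · rintro (rfl | rfl)
    · exact Equiv.Perm.SameCycle.refl _ _
    · exact ⟨1, by simp⟩

theorem tail_surjective : Function.Surjective M.tail := Quotient.mk_surjective

theorem edge_surjective : Function.Surjective M.edge := Quotient.mk_surjective

theorem left_surjective : Function.Surjective M.left := Quotient.mk_surjective

@[simp] theorem opp_opp_apply (x : D) : M.opp (M.opp x) = x := M.opp_opp x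

@[simp] theorem tail_rot (x : D) : M.tail (M.rot x) = M.tail x :=
  M.tail_eq_tail_iff.2 ⟨-1, by simp⟩

@[simp] theorem tail_rot_symm (x : D) : M.tail (M.rot.symm x) = M.tail x := by
  rw [← M.tail_rot, Equiv.apply_symm_apply]

@[simp] theorem edge_opp (x : D) : M.edge (M.opp x) = M.edge x :=
  M.edge_eq_edge_iff.2 (Or.inr (M.opp_opp x).symm)

@[simp] theorem left_facePerm (x : D) : M.left (M.facePerm x) = M.left x :=
  M.left_eq_left_iff.2 ⟨-1, by simp⟩

@[simp] theorem left_opp (x : D) : M.left (M.opp x) = M.right x := rfl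

@[simp] theorem right_opp (x : D) : M.right (M.opp x) = M.left x := by
  simp [right, M.opp_opp]

@[simp] theorem tail_opp (x : D) : M.tail (M.opp x) = M.head x := rfl

@[simp] theorem head_opp (x : D) : M.head (M.opp x) = M.tail x := by
  simp [head, M.opp_opp]

theorem facePerm_apply (x : D) : M.facePerm x = M.rot.symm (M.opp x) := rfl

@[simp] theorem tail_facePerm (x : D) : M.tail (M.facePerm x) = M.head x := by
  rw [facePerm_apply, tail_rot_symm, tail_opp]

theorem left_rot_symm (x : D) : M.left (M.rot.symm x) = M.right x := by
  have := M.left_facePerm (M.opp x)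
  rwa [facePerm_apply, opp_opp_apply] at this

@[simp] theorem right_rot (x : D) : M.right (M.rot x) = M.left x := by
  rw [← left_rot_symm, Equiv.symm_apply_apply]

/-- Invariance under the two generators passes to the group they generate, which is transitive on
darts. -/
theorem forall_of_rot_opp {P : D → Prop} (hr : ∀ x, P (M.rot x) ↔ P x)
    (ho : ∀ x, P (M.opp x) ↔ P x) {x : D} (hx : P x) (y : D) : P y := by
  obtain ⟨g, hg, rfl⟩ := M.connected x y
  have : ∀ z, P (g z) ↔ P z := by
    induction hg using Subgroup.closure_induction with
    | mem g hg =>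
      rcases hg with rfl | rfl
      · exact hr
      · exact ho
    | one => simp
    | mul a b _ _ ha hb => intro z; rw [Equiv.Perm.mul_apply, ha, hb]
    | inv a _ ha => intro z; rw [← ha, ← Equiv.Perm.mul_apply]; simp
  exact (this x).2 hx

/-- The dual graph is connected. -/
theorem face_induction {P : M.Face → Prop} (h : ∀ x, P (M.left x) ↔ P (M.right x))
    {f : M.Face} (hf : P f) (g : M.Face) : P g := by
  obtain ⟨x, rfl⟩ := M.left_surjective f
  obtain ⟨y, rfl⟩ := M.left_surjective g
  refine M.forall_of_rot_opp (P := fun z => P (M.left z)) (fun z => ?_) (fun z => ?_) hf y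
  · rw [h, right_rot]
  · rw [left_opp, h]

theorem sameSide_symm {C : Set M.Edge} {f g : M.Face} (h : M.SameSide C f g) :
    M.SameSide C g f := by
  refine (@Relation.ReflTransGen.stdSymm _ _ ⟨?_⟩).symm _ _ h
  rintro _ _ ⟨x, hx, rfl, rfl⟩
  exact ⟨M.opp x, by simpa using hx, rfl, by simp⟩

theorem SameSide.trans {C : Set M.Edge} {f g k : M.Face} (h : M.SameSide C f g)
    (h' : M.SameSide C g k) : M.SameSide C f k := Relation.ReflTransGen.trans h h'

theorem sameSide_refl (C : Set M.Edge) (f : M.Face) : M.SameSide C f f :=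
  Relation.ReflTransGen.refl

theorem sameSide_left_right {C : Set M.Edge} {x : D} (hx : M.edge x ∉ C) :
    M.SameSide C (M.left x) (M.right x) :=
  Relation.ReflTransGen.single ⟨x, hx, rfl, rfl⟩

theorem SameSide.induction {C : Set M.Edge} {f g : M.Face} (h : M.SameSide C f g)
    {P : M.Face → Prop} (hP : ∀ x, M.edge x ∉ C → P (M.left x) → P (M.right x)) (hf : P f) :
    P g := by
  induction h with
  | refl => exact hf
  | tail _ hs ih =>
    obtain ⟨x, hx, rfl, rfl⟩ := hs
    exact hP x hx ih

/-- The regions of the complement of a set of edges. -/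
def regionSetoid (C : Set M.Edge) : Setoid M.Face where
  r := M.SameSide C
  iseqv := ⟨M.sameSide_refl C, M.sameSide_symm, SameSide.trans M⟩

end Basic

/-! ### Flows, potentials and Euler's inequality. -/

section Linear

variable {D : Type*} [Fintype D] (M : PlanarMap D)

instance : Finite M.Vertex := Quotient.finite _
instance : Finite M.Edge := Quotient.finite _
instance : Finite M.Face := Quotient.finite _
noncomputable instance : Fintype M.Vertex := Fintype.ofFinite _
noncomputable instance : Fintype M.Edge := Fintype.ofFinite _
noncomputable instance : Fintype M.Face := Fintype.ofFinite _

theorem euler_card : Fintype.card M.Vertex + Fintype.card M.Face = Fintype.card M.Edge + 2 := by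
  have h := M.euler
  change (Nat.card M.Vertex : ℤ) - Nat.card M.Edge + Nat.card M.Face = 2 at h
  simp only [Nat.card_eq_fintype_card] at h
  omega

/-- A chosen half of each edge. -/
noncomputable def edgeRep (e : M.Edge) : D := (M.edge_surjective e).choose

@[simp] theorem edge_edgeRep (e : M.Edge) : M.edge (M.edgeRep e) = e :=
  (M.edge_surjective e).choose_spec

/-- Orienting each edge by its chosen half identifies antisymmetric functions on darts with
functions on edges, a space of known dimension. -/
noncomputable def sign (x : D) : ℚ := if M.edgeRep (M.edge x) = x then 1 else -1

theorem edgeRep_edge (x : D) : M.edgeRep (M.edge x) = x ∨ M.edgeRep (M.edge x) = M.opp x :=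
  M.edge_eq_edge_iff.1 (M.edge_edgeRep (M.edge x)).symm

@[simp] theorem sign_opp (x : D) : M.sign (M.opp x) = -M.sign x := by
  rcases M.edgeRep_edge x with h | h
  · simp [sign, h, (M.opp_ne x).symm]
  · simp [sign, h, M.opp_ne x]

theorem sign_mul_self (x : D) : M.sign x * M.sign x = 1 := by
  unfold sign; split_ifs <;> norm_num

/-- The antisymmetric function on darts given by a function on edges. -/
noncomputable def ofEdge : (M.Edge → ℚ) →ₗ[ℚ] (D → ℚ) where
  toFun φ x := φ (M.edge x) * M.sign x
  map_add' φ ψ := by ext; simp [add_mul]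
  map_smul' c φ := by ext; simp [mul_assoc]

/-- The total outgoing flow at each vertex. -/
noncomputable def divergence : (D → ℚ) →ₗ[ℚ] (M.Vertex → ℚ) where
  toFun δ v := ∑ x with M.tail x = v, δ x
  map_add' φ ψ := by ext; simp [Finset.sum_add_distrib]
  map_smul' c φ := by ext; simp [Finset.mul_sum]

/-- The variation of a function on faces across darts. -/
noncomputable def grad : (M.Face → ℚ) →ₗ[ℚ] (D → ℚ) where
  toFun h x := h (M.left x) - h (M.right x)
  map_add' φ ψ := by ext; simp; ring
  map_smul' c φ := by ext; simp; ring

theorem ofEdge_apply (φ : M.Edge → ℚ) (x : D) : M.ofEdge φ x = φ (M.edge x) * M.sign x := rfl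

theorem divergence_apply (δ : D → ℚ) (v : M.Vertex) :
    M.divergence δ v = ∑ x with M.tail x = v, δ x := rfl

theorem grad_apply (h : M.Face → ℚ) (x : D) : M.grad h x = h (M.left x) - h (M.right x) := rfl

theorem ofEdge_opp (φ : M.Edge → ℚ) (x : D) : M.ofEdge φ (M.opp x) = -M.ofEdge φ x := by
  simp [ofEdge_apply]

theorem ofEdge_injective : Function.Injective M.ofEdge := by
  intro φ ψ h
  ext e
  obtain ⟨x, rfl⟩ := M.edge_surjective e
  have := congrArg (· * M.sign x) (congrFun h x)
  simpa [ofEdge_apply, mul_assoc, sign_mul_self] using this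

theorem exists_ofEdge_eq {δ : D → ℚ} (hδ : ∀ x, δ (M.opp x) = -δ x) : ∃ φ, M.ofEdge φ = δ := by
  refine ⟨fun e => δ (M.edgeRep e), ?_⟩
  ext x
  rcases M.edgeRep_edge x with h | h
  · simp [ofEdge_apply, sign, h]
  · simp [ofEdge_apply, sign, h, M.opp_ne, hδ]

theorem sum_tail_rot {α : Type*} [AddCommMonoid α] (g : D → α) (v : M.Vertex) :
    ∑ x with M.tail x = v, g (M.rot x) = ∑ x with M.tail x = v, g x :=
  Finset.sum_equiv M.rot (by simp) (by simp)

/-- The face to the right of `rot x` is the face to the left of `x`, so the sum around a vertex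
telescopes. -/
theorem divergence_grad (h : M.Face → ℚ) : M.divergence (M.grad h) = 0 := by
  ext v
  rw [divergence_apply, ← M.sum_tail_rot]
  simp only [grad_apply, right_rot, Finset.sum_sub_distrib]
  rw [M.sum_tail_rot (fun x => h (M.left x))]
  simp

theorem sum_divergence (δ : D → ℚ) : ∑ v, M.divergence δ v = ∑ x, δ x := by
  simp only [divergence_apply]
  exact Finset.sum_fiberwise _ _ _

theorem sum_opp {α : Type*} [AddCommMonoid α] (g : D → α) : ∑ x, g (M.opp x) = ∑ x, g x :=
  Equiv.sum_comp M.opp g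

theorem sum_eq_zero_of_antisymm {δ : D → ℚ} (hδ : ∀ x, δ (M.opp x) = -δ x) : ∑ x, δ x = 0 := by
  have := M.sum_opp δ
  simp only [hδ, Finset.sum_neg_distrib] at this
  linarith

/-- The unit flow along the dart `x`. -/
noncomputable def unitFlow (x : D) : M.Edge → ℚ := Pi.single (M.edge x) (M.sign x)

theorem ofEdge_unitFlow (x y : D) :
    M.ofEdge (M.unitFlow x) y = (if y = x then 1 else 0) - (if y = M.opp x then 1 else 0) := by
  rw [ofEdge_apply, unitFlow, Pi.single_apply]
  have key : M.edge y = M.edge x ↔ y = x ∨ y = M.opp x := by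
    rw [eq_comm, edge_eq_edge_iff]
  by_cases h1 : y = x
  · subst h1
    simp [sign_mul_self, (M.opp_ne y).symm]
  · by_cases h2 : y = M.opp x
    · subst h2
      simp [sign_mul_self, M.opp_ne x]
    · simp [key, h1, h2]

theorem divergence_unitFlow (x : D) :
    M.divergence (M.ofEdge (M.unitFlow x)) = Pi.single (M.tail x) 1 - Pi.single (M.head x) 1 := by
  ext v
  simp only [divergence_apply, ofEdge_unitFlow, Finset.sum_sub_distrib, Pi.sub_apply,
    Pi.single_apply]
  simp [Finset.sum_ite_eq', eq_comm]

/-- By connectedness, the differences of unit masses at the ends of darts, together with a single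
unit mass, span all functions on vertices. -/
theorem card_vertex_le_finrank : Fintype.card M.Vertex ≤
    Module.finrank ℚ (LinearMap.range (M.divergence ∘ₗ M.ofEdge)) + 1 := by
  rcases isEmpty_or_nonempty D with hD | ⟨⟨x₀⟩⟩
  · have : IsEmpty M.Vertex := ⟨fun v => hD.elim (M.tail_surjective v).choose⟩
    simp
  set R := LinearMap.range (M.divergence ∘ₗ M.ofEdge)
  set T := R ⊔ Submodule.span ℚ {(Pi.single (M.tail x₀) 1 : M.Vertex → ℚ)}
  have hstep : ∀ x, (Pi.single (M.tail x) 1 - Pi.single (M.head x) 1 : M.Vertex → ℚ) ∈ T := by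
    intro x
    rw [← divergence_unitFlow]
    exact Submodule.mem_sup_left ⟨_, rfl⟩
  have hall : ∀ x, (Pi.single (M.tail x) 1 : M.Vertex → ℚ) ∈ T := by
    refine fun x => M.forall_of_rot_opp (P := fun x => (Pi.single (M.tail x) 1 : M.Vertex → ℚ) ∈ T)
      (fun z => by rw [tail_rot]) (fun z => ?_)
      (Submodule.mem_sup_right (Submodule.mem_span_singleton_self _)) x
    rw [tail_opp]
    exact ⟨fun h => by simpa using T.add_mem (hstep z) h, fun h => by
      simpa using T.sub_mem h (hstep z)⟩
  have htop : T = ⊤ := by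
    rw [eq_top_iff]
    intro f _
    rw [pi_eq_sum_univ' f]
    refine T.sum_mem fun v _ => T.smul_mem _ ?_
    obtain ⟨x, rfl⟩ := M.tail_surjective v
    convert hall x using 1
  calc Fintype.card M.Vertex = Module.finrank ℚ (⊤ : Submodule ℚ (M.Vertex → ℚ)) := by
        simp
    _ = Module.finrank ℚ T := by rw [htop]
    _ ≤ _ := (Submodule.finrank_add_le_finrank_add_finrank _ _).trans
      (Nat.add_le_add_left (by simpa using finrank_span_le_card (R := ℚ) {(_ : _ → ℚ)}) _)

/-- The dual graph is connected, so only constants have zero gradient. -/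
theorem finrank_range_grad : Fintype.card M.Face ≤ Module.finrank ℚ (LinearMap.range M.grad) + 1 := by
  have h := LinearMap.finrank_range_add_finrank_ker M.grad
  rw [Module.finrank_fintype_fun_eq_card] at h
  have hk : LinearMap.ker M.grad ≤ Submodule.span ℚ {(fun _ => 1 : M.Face → ℚ)} := by
    intro g hg
    rw [Submodule.mem_span_singleton]
    have hg' : ∀ x, g (M.left x) = g (M.right x) := fun x => by
      have := congrFun (LinearMap.mem_ker.1 hg) x
      rw [grad_apply] at this
      simpa [sub_eq_zero] using this
    rcases isEmpty_or_nonempty M.Face with hF | ⟨⟨f₀⟩⟩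
    · exact ⟨0, by ext f; exact hF.elim f⟩
    · refine ⟨g f₀, ?_⟩
      ext f
      have := M.face_induction (P := fun f => g f = g f₀) (fun x => by rw [hg']) rfl f
      simp [this]
  have := (Submodule.finrank_mono hk).trans (by simpa using finrank_span_le_card (R := ℚ) {(_ : _ → ℚ)})
  omega

/-- Discrete Poincaré lemma: on the sphere, every divergence-free flow is a gradient. -/
theorem exists_grad_eq {δ : D → ℚ} (hδ : ∀ x, δ (M.opp x) = -δ x) (hd : M.divergence δ = 0) :
    ∃ h, M.grad h = δ := by
  set K := (LinearMap.ker (M.divergence ∘ₗ M.ofEdge)).map M.ofEdge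
  have hle : LinearMap.range M.grad ≤ K := by
    rintro _ ⟨h, rfl⟩
    obtain ⟨φ, hφ⟩ := M.exists_ofEdge_eq (δ := M.grad h) (fun x => by simp [grad_apply])
    refine ⟨φ, ?_, hφ⟩
    simp [hφ, divergence_grad]
  have hK : Module.finrank ℚ K = Module.finrank ℚ (LinearMap.ker (M.divergence ∘ₗ M.ofEdge)) :=
    (Submodule.equivMapOfInjective _ M.ofEdge_injective _).finrank_eq.symm
  have h1 := LinearMap.finrank_range_add_finrank_ker (M.divergence ∘ₗ M.ofEdge)
  rw [Module.finrank_fintype_fun_eq_card] at h1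
  have h2 := M.card_vertex_le_finrank
  have h3 := M.finrank_range_grad
  have h4 := M.euler_card
  -- The gradients have dimension at least `F - 1`, the divergence-free flows at most `E - (V - 1)`;
  -- Euler's relation makes these bounds equal.
  have heq := Submodule.eq_of_le_of_finrank_le hle (by omega)
  obtain ⟨φ, hφ⟩ := M.exists_ofEdge_eq hδ
  have : δ ∈ K := ⟨φ, by simp [hφ, hd], hφ⟩
  rw [← heq] at this
  exact this

theorem eq_of_sameSide_of_grad {C : Set M.Edge} {h : M.Face → ℚ}
    (hh : ∀ x, M.edge x ∉ C → M.grad h x = 0) {f g : M.Face} (hfg : M.SameSide C f g) :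
    h f = h g :=
  SameSide.induction M hfg (P := fun g => h f = h g)
    (fun x hx hf => by rw [hf, ← sub_eq_zero]; exact hh x hx) rfl

/-- Euler's inequality for the submap spanned by a nonempty set `H` of edges, where `W` contains the
vertices of the submap and `r` separates its faces. -/
theorem card_add_two_le {ρ : Type*} [Fintype ρ] {H : Finset M.Edge} (hH : H.Nonempty)
    {W : Finset M.Vertex} (hW : ∀ x, M.edge x ∈ H → M.tail x ∈ W) (r : M.Face → ρ)
    (hr : ∀ f g, r f = r g → M.SameSide (H : Set M.Edge) f g) :
    H.card + 2 ≤ W.card + Fintype.card ρ := by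
  obtain ⟨e₀, he₀⟩ := hH
  obtain ⟨x₀, rfl⟩ := M.edge_surjective e₀
  have hw₀ := hW x₀ he₀
  let ext : (H → ℚ) →ₗ[ℚ] (M.Edge → ℚ) :=
    Function.ExtendByZero.linearMap ℚ (Subtype.val : H → M.Edge)
  have hext : ∀ φ e, e ∉ H → ext φ e = 0 := by
    intro φ e he
    change Function.extend _ _ _ _ = _
    rw [Function.extend_apply']
    · rfl
    · rintro ⟨a, rfl⟩; exact he a.2
  have hext_inj : Function.Injective ext := by
    intro φ ψ h
    ext e
    have := congrFun h e
    change Function.extend _ _ _ _ = Function.extend _ _ _ _ at this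
    rwa [Subtype.val_injective.extend_apply, Subtype.val_injective.extend_apply] at this
  let L := M.divergence ∘ₗ M.ofEdge ∘ₗ ext
  -- Divergences sum to zero, so forgetting the coordinate at `M.tail x₀` loses nothing: the rank is
  -- at most `W.card - 1`.
  let P : (M.Vertex → ℚ) →ₗ[ℚ] (W.erase (M.tail x₀) → ℚ) := LinearMap.funLeft ℚ ℚ Subtype.val
  have hLW : ∀ φ v, v ∉ W → L φ v = 0 := by
    intro φ v hv
    change M.divergence (M.ofEdge (ext φ)) v = 0
    rw [divergence_apply]
    refine Finset.sum_eq_zero fun x hx => ?_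
    rw [ofEdge_apply, hext, zero_mul]
    intro hxe
    exact hv ((Finset.mem_filter.1 hx).2 ▸ hW x hxe)
  have hLsum : ∀ φ, ∑ v, L φ v = 0 := by
    intro φ
    change ∑ v, M.divergence (M.ofEdge (ext φ)) v = 0
    rw [sum_divergence]
    exact M.sum_eq_zero_of_antisymm (M.ofEdge_opp _)
  have hker : LinearMap.ker (P ∘ₗ L) ≤ LinearMap.ker L := by
    intro φ hφ
    have h1 : ∀ v, v ≠ M.tail x₀ → L φ v = 0 := by
      intro v hv
      by_cases hvW : v ∈ W
      · exact congrFun (LinearMap.mem_ker.1 hφ) ⟨v, Finset.mem_erase.2 ⟨hv, hvW⟩⟩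
      · exact hLW φ v hvW
    have h2 := hLsum φ
    rw [Finset.sum_eq_single (M.tail x₀) (fun v _ => h1 v) (by simp)] at h2
    rw [LinearMap.mem_ker]
    ext v
    by_cases hv : v = M.tail x₀
    · rw [hv, h2]; rfl
    · exact h1 v hv
  have h1 := LinearMap.finrank_range_add_finrank_ker (P ∘ₗ L)
  have h2 : Module.finrank ℚ (LinearMap.range (P ∘ₗ L)) ≤ W.card - 1 := by
    refine (Submodule.finrank_le _).trans ?_
    rw [Module.finrank_fintype_fun_eq_card, Fintype.card_coe, Finset.card_erase_of_mem hw₀]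
  have h3 := Submodule.finrank_mono hker
  rw [Module.finrank_fintype_fun_eq_card, Fintype.card_coe] at h1
  let G : (ρ → ℚ) →ₗ[ℚ] (D → ℚ) := M.grad ∘ₗ LinearMap.funLeft ℚ ℚ r
  -- A divergence-free flow carried by `H` has a potential that is constant on the regions of `H`,
  -- hence factors through `r`.
  have hG : (LinearMap.ker L).map (M.ofEdge ∘ₗ ext) ≤ LinearMap.range G := by
    rintro _ ⟨φ, hφ, rfl⟩
    obtain ⟨h, hh⟩ := M.exists_grad_eq (δ := M.ofEdge (ext φ)) (M.ofEdge_opp _) hφ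
    have hfac : Function.FactorsThrough h r := fun f g hfg =>
      M.eq_of_sameSide_of_grad (fun x hx => by
        rw [hh, ofEdge_apply, hext _ _ hx, zero_mul]) (hr f g hfg)
    refine ⟨Function.extend r h 0, ?_⟩
    change M.grad (Function.extend r h 0 ∘ r) = _
    have : Function.extend r h 0 ∘ r = h := funext fun f => hfac.extend_apply _ f
    rw [this, hh]
    rfl
  have h4 := Submodule.finrank_mono hG
  rw [← (Submodule.equivMapOfInjective (M.ofEdge ∘ₗ ext)
    (M.ofEdge_injective.comp hext_inj) (LinearMap.ker L)).finrank_eq] at h4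
  have h5 := LinearMap.finrank_range_add_finrank_ker G
  rw [Module.finrank_fintype_fun_eq_card] at h5
  -- The constants are lost, so these flows have dimension at most `|ρ| - 1`.
  have h6 : 0 < Module.finrank ℚ (LinearMap.ker G) := by
    have : Nontrivial (LinearMap.ker G) := by
      refine ⟨⟨⟨fun _ => 1, ?_⟩, 0, fun h => ?_⟩⟩
      · rw [LinearMap.mem_ker]
        ext x
        change (1 : ℚ) - 1 = 0
        simp
      · have := congrFun (congrArg Subtype.val h) (r (M.left x₀))
        simp at this
    exact Module.finrank_pos
  have h7 : 0 < W.card := Finset.card_pos.2 ⟨_, hw₀⟩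
  omega

end Linear

end PlanarMap

/-! ### Simple cycles, Jordan's theorem and contours of sets of faces. -/

namespace PlanarMap

section Cycles

variable {D : Type*} (M : PlanarMap D)

variable {M} in
theorem edge_mem_edgesOf {c : List D} {x : D} :
    M.edge x ∈ M.edgesOf c ↔ x ∈ c ∨ M.opp x ∈ c := by
  constructor
  · rintro ⟨y, hy, h⟩
    rcases M.edge_eq_edge_iff.1 h with rfl | rfl
    · exact Or.inl hy
    · right; simpa using hy
  · rintro (h | h)
    · exact ⟨x, h, rfl⟩
    · exact ⟨_, h, M.edge_opp x⟩

namespace IsSimpleCycle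

variable {M} {c : List D} (hc : M.IsSimpleCycle c)
include hc

theorem tail_inj {x y : D} (hx : x ∈ c) (hy : y ∈ c) (h : M.tail x = M.tail y) : x = y :=
  List.inj_on_of_nodup_map hc.2.2.1 hx hy h

theorem nodup : c.Nodup := hc.2.2.1.of_map _

theorem opp_notMem {x : D} (hx : x ∈ c) : M.opp x ∉ c := fun h =>
  M.opp_ne x (List.inj_on_of_nodup_map hc.2.2.2 h hx (M.edge_opp x))

theorem chain_mem {r : D → D → Prop}
    (hr : ∀ x ∈ c, ∀ y ∈ c, M.head x = M.tail y → r x y) : (c : Cycle D).Chain r := by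
  obtain ⟨a, l, rfl⟩ := List.exists_cons_of_ne_nil hc.1
  have h := hc.2.1
  rw [Cycle.chain_coe_cons] at h ⊢
  refine h.imp_of_mem_imp fun x y hx hy hxy => hr x ?_ y ?_ hxy
  · simp at hx ⊢; tauto
  · simp at hy ⊢; tauto

/-- A transitive relation holding between successive darts holds between any two darts. -/
theorem rel_of_succ {r : D → D → Prop} (ht : ∀ x y z, r x y → r y z → r x z)
    (hr : ∀ x ∈ c, ∀ y ∈ c, M.head x = M.tail y → r x y) {x y : D} (hx : x ∈ c) (hy : y ∈ c) :
    r x y := by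
  have : IsTrans D r := ⟨ht⟩
  exact Cycle.chain_iff_pairwise.1 (hc.chain_mem hr) x hx y hy

theorem exists_succ {x : D} (hx : x ∈ c) : ∃ y ∈ c, M.head x = M.tail y :=
  hc.rel_of_succ (r := fun x _ => ∃ z ∈ c, M.head x = M.tail z) (fun _ _ _ h _ => h)
    (fun _ _ y hy h => ⟨y, hy, h⟩) hx hx

theorem exists_pred {x : D} (hx : x ∈ c) : ∃ y ∈ c, M.head y = M.tail x :=
  hc.rel_of_succ (r := fun _ x => ∃ z ∈ c, M.head z = M.tail x) (fun _ _ _ _ h => h)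
    (fun y hy _ _ h => ⟨y, hy, h⟩) hx hx

theorem image_tail : c.toFinset.image M.tail = c.toFinset.image M.head := by
  ext v
  simp only [Finset.mem_image, List.mem_toFinset]
  constructor
  · rintro ⟨x, hx, rfl⟩; exact hc.exists_pred hx
  · rintro ⟨x, hx, rfl⟩
    obtain ⟨y, hy, h⟩ := hc.exists_succ hx
    exact ⟨y, hy, h.symm⟩

theorem card_image_tail : (c.toFinset.image M.tail).card = c.length := by
  rw [Finset.card_image_of_injOn, List.toFinset_card_of_nodup hc.nodup]
  intro x hx y hy h
  exact hc.tail_inj (by simpa using hx) (by simpa using hy) h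

theorem head_inj {x y : D} (hx : x ∈ c) (hy : y ∈ c) (h : M.head x = M.head y) : x = y := by
  have : Set.InjOn M.head (c.toFinset : Set D) := by
    rw [← Finset.card_image_iff, ← hc.image_tail, hc.card_image_tail,
      List.toFinset_card_of_nodup hc.nodup]
  exact this (by simpa using hx) (by simpa using hy) h

end IsSimpleCycle

/-- The darts having on their left, but not on their right, a face of `S`. -/
def boundaryDarts (S : Set M.Face) : Set D := {x | M.left x ∈ S ∧ M.right x ∉ S}

theorem exists_mem_boundaryDarts {S : Set M.Face} {f g : M.Face} (hf : f ∈ S) (hg : g ∉ S) :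
    ∃ x, x ∈ M.boundaryDarts S := by
  by_contra! h
  have h' : ∀ x, M.left x ∈ S → M.right x ∈ S := fun x hx => by
    by_contra hn
    exact h x ⟨hx, hn⟩
  exact hg (M.face_induction (P := (· ∈ S))
    (fun x => ⟨h' x, fun hx => by simpa using h' (M.opp x) hx⟩) hf g)

variable [Fintype D]

/-- The orbit is finite, so stepping in one direction reaches all of it and a one-way implication
suffices. -/
theorem tail_induction {P : D → Prop} {x : D} (hx : P x)
    (h : ∀ z, M.tail z = M.tail x → P z → P (M.rot.symm z)) {y : D} (hy : M.tail y = M.tail x) :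
    P y := by
  have hs : (M.rot⁻¹).SameCycle x y := Equiv.Perm.sameCycle_inv.2 (M.tail_eq_tail_iff.1 hy.symm)
  obtain ⟨n, -, rfl⟩ := hs.exists_pow_eq'
  have : ∀ n, M.tail ((M.rot⁻¹ ^ n) x) = M.tail x ∧ P ((M.rot⁻¹ ^ n) x) := by
    intro n
    induction n with
    | zero => exact ⟨rfl, hx⟩
    | succ n ih =>
      rw [pow_succ', Equiv.Perm.mul_apply]
      exact ⟨(M.tail_rot_symm _).trans ih.1, h _ ih.1 ih.2⟩
  exact (this n).2

theorem left_induction {P : D → Prop} {x : D} (hx : P x)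
    (h : ∀ z, M.left z = M.left x → P z → P (M.facePerm z)) {y : D} (hy : M.left y = M.left x) :
    P y := by
  obtain ⟨n, -, rfl⟩ := (M.left_eq_left_iff.1 hy.symm).exists_pow_eq'
  have : ∀ n, M.left ((M.facePerm ^ n) x) = M.left x ∧ P ((M.facePerm ^ n) x) := by
    intro n
    induction n with
    | zero => exact ⟨rfl, hx⟩
    | succ n ih =>
      rw [pow_succ', Equiv.Perm.mul_apply]
      exact ⟨(M.left_facePerm _).trans ih.1, h _ ih.1 ih.2⟩
  exact (this n).2

theorem left_induction_symm {P : D → Prop} {x : D} (hx : P x)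
    (h : ∀ z, M.left z = M.left x → P (M.facePerm z) → P z) {y : D} (hy : M.left y = M.left x) :
    P y := by
  obtain ⟨n, -, hn⟩ := (M.left_eq_left_iff.1 hy).exists_pow_eq'
  induction n generalizing y with
  | zero => exact (show y = x from hn) ▸ hx
  | succ n ih =>
    rw [pow_succ, Equiv.Perm.mul_apply] at hn
    exact h y hy (ih ((M.left_facePerm y).trans hy) hn)

/-- Turning around the end of `x` from its left face, in `S`, to its right face, outside `S`, some
dart must be crossed where `S` is left. -/
theorem exists_succ_mem_boundaryDarts {S : Set M.Face} {x : D} (hx : x ∈ M.boundaryDarts S) :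
    ∃ y ∈ M.boundaryDarts S, M.tail y = M.head x := by
  by_contra! h
  refine hx.2 (M.tail_induction (P := fun z => M.left z ∈ S) (x := M.facePerm x)
    (by simpa using hx.1) (fun z hz hzS => ?_) (y := M.opp x) (by simp))
  rw [left_rot_symm]
  by_contra hn
  exact h z ⟨hzS, hn⟩ (by simpa using hz)

/-- Choose one successor for each vertex and iterate: the walk is eventually periodic. A dart of the
periodic part is determined by its origin, so one minimal period repeats no vertex. -/
theorem exists_isSimpleCycle {X : Set D} (hne : X.Nonempty)
    (hs : ∀ x ∈ X, ∃ y ∈ X, M.tail y = M.head x) (ho : ∀ x ∈ X, M.opp x ∉ X) :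
    ∃ c, M.IsSimpleCycle c ∧ ∀ x ∈ c, x ∈ X := by
  obtain ⟨x₀, hx₀⟩ := hne
  let g : M.Vertex → D := fun v => if h : ∃ y ∈ X, M.tail y = v then h.choose else x₀
  have hg : ∀ x ∈ X, g (M.head x) ∈ X ∧ M.tail (g (M.head x)) = M.head x := by
    intro x hx
    simp only [g, dif_pos (hs x hx)]
    exact (hs x hx).choose_spec
  set n : D → D := fun x => g (M.head x)
  have hX : ∀ i, n^[i] x₀ ∈ X := by
    intro i
    induction i with
    | zero => exact hx₀
    | succ i ih => rw [Function.iterate_succ_apply']; exact (hg _ ih).1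
  obtain ⟨i, j, hij, he⟩ : ∃ i j, i < j ∧ n^[i] x₀ = n^[j] x₀ := by
    obtain ⟨i, j, hij, he⟩ := Finite.exists_ne_map_eq_of_infinite (fun i => n^[i] x₀)
    rcases lt_or_gt_of_ne hij with h | h
    · exact ⟨i, j, h, he⟩
    · exact ⟨j, i, h, he.symm⟩
  set x := n^[i] x₀
  have hxX : ∀ k, n^[k] x ∈ X := fun k => by
    rw [← Function.iterate_add_apply]; exact hX _
  have hper : x ∈ Function.periodicPts n := by
    refine Function.mk_mem_periodicPts (n := j - i) (by omega) ?_
    change n^[j - i] (n^[i] x₀) = n^[i] x₀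
    rw [← Function.iterate_add_apply, Nat.sub_add_cancel hij.le, ← he]
  have hpos := Function.minimalPeriod_pos_of_mem_periodicPts hper
  set m := Function.minimalPeriod n x
  have htail : ∀ k l, M.tail (n^[k] x) = M.tail (n^[l] x) → n^[k] x = n^[l] x := by
    have key : ∀ k, n^[k] x = g (M.tail (n^[k] x)) := by
      intro k
      rw [← Function.iterate_add_minimalPeriod_eq (n := k)]
      obtain ⟨k', hk'⟩ : ∃ k', k + Function.minimalPeriod n x = k' + 1 :=
        ⟨k + m - 1, by omega⟩
      rw [hk', Function.iterate_succ_apply']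
      change g _ = g (M.tail (g _))
      rw [(hg _ (hxX k')).2]
    intro k l h
    rw [key k, key l, h]
  have hmem : ∀ z ∈ (List.range m).map fun k => n^[k] x, ∃ k, z = n^[k] x := by
    intro z hz
    obtain ⟨k, -, rfl⟩ := List.mem_map.1 hz
    exact ⟨k, rfl⟩
  have hnd : ((List.range m).map fun k => n^[k] x).Nodup := by
    have := Function.nodup_periodicOrbit (f := n) (x := x)
    rwa [Function.periodicOrbit_def, Cycle.nodup_coe_iff] at this
  refine ⟨(List.range m).map fun k => n^[k] x, ⟨?_, ?_, ?_, ?_⟩, ?_⟩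
  · simp [hpos.ne']
  · have := (Function.periodicOrbit_chain (fun x y => M.head x = M.tail y) (f := n) (x := x)).2
      (fun k _ => by
        rw [Function.iterate_succ_apply']
        exact (hg _ (hxX k)).2.symm)
    rwa [Function.periodicOrbit_def] at this
  · refine hnd.map_on fun y hy z hz h => ?_
    obtain ⟨k, rfl⟩ := hmem y hy
    obtain ⟨l, rfl⟩ := hmem z hz
    exact htail k l h
  · refine hnd.map_on fun y hy z hz h => ?_
    obtain ⟨k, rfl⟩ := hmem y hy
    obtain ⟨l, rfl⟩ := hmem z hz
    rcases M.edge_eq_edge_iff.1 h with h | h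
    · exact h.symm
    · exact absurd (h ▸ hxX l) (ho _ (hxX k))
  · intro z hz
    obtain ⟨k, rfl⟩ := hmem z hz
    exact hxX k

theorem exists_isSimpleCycle_boundaryDarts {S : Set M.Face} {f g : M.Face} (hf : f ∈ S)
    (hg : g ∉ S) : ∃ c, M.IsSimpleCycle c ∧ ∀ x ∈ c, x ∈ M.boundaryDarts S :=
  M.exists_isSimpleCycle (M.exists_mem_boundaryDarts hf hg)
    (fun _ hx => M.exists_succ_mem_boundaryDarts hx)
    (fun x hx h => h.2 (by simpa using hx.1))

namespace IsSimpleCycle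

variable {M} {c : List D} (hc : M.IsSimpleCycle c)
include hc

theorem eq_or_eq_opp {x y z : D} (hx : x ∈ c) (hy : y ∈ c) (hxy : M.head x = M.tail y)
    (hz : M.tail z = M.tail y) (hzc : M.edge z ∈ M.edgesOf c) : z = y ∨ z = M.opp x := by
  rcases edge_mem_edgesOf.1 hzc with h | h
  · exact Or.inl (hc.tail_inj h hy hz)
  · right
    rw [← hc.head_inj h hx (by simpa [hxy] using hz)]
    simp

theorem sameSide_left {x y : D} (hx : x ∈ c) (hy : y ∈ c) :
    M.SameSide (M.edgesOf c) (M.left x) (M.left y) := by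
  refine hc.rel_of_succ (r := fun x y => M.SameSide (M.edgesOf c) (M.left x) (M.left y))
    (fun _ _ _ h h' => SameSide.trans M h h') (fun x hx y hy hxy => ?_) hx hy
  by_contra hn
  -- Turning clockwise from `facePerm x`, the only darts at this vertex lying over the cycle are
  -- `y`, where the walk is done, and `opp x`, which leads back to the start.
  refine hn (M.tail_induction (P := fun z => M.SameSide (M.edgesOf c) (M.left x) (M.left z))
    (x := M.facePerm x) (by simpa using M.sameSide_refl _ _) (fun z hz h => ?_)
    (by simpa using hxy.symm))
  rw [tail_facePerm, hxy] at hz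
  by_cases hzc : M.edge z ∈ M.edgesOf c
  · rcases hc.eq_or_eq_opp hx hy hxy hz hzc with rfl | rfl
    · exact absurd h hn
    · rw [← facePerm_apply, left_facePerm]; exact M.sameSide_refl _ _
  · rw [left_rot_symm]
    exact SameSide.trans M h (M.sameSide_left_right hzc)

theorem sameSide_right {x y : D} (hx : x ∈ c) (hy : y ∈ c) :
    M.SameSide (M.edgesOf c) (M.right x) (M.right y) := by
  refine hc.rel_of_succ (r := fun x y => M.SameSide (M.edgesOf c) (M.right x) (M.right y))
    (fun _ _ _ h h' => SameSide.trans M h h') (fun x hx y hy hxy => M.sameSide_symm ?_) hx hy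
  by_contra hn
  refine hn (M.tail_induction (P := fun z => M.SameSide (M.edgesOf c) (M.right y) (M.left z))
    (x := M.rot.symm y) (by simpa [left_rot_symm] using M.sameSide_refl _ _) (fun z hz h => ?_)
    (y := M.opp x) (by simpa using hxy))
  rw [tail_rot_symm] at hz
  by_cases hzc : M.edge z ∈ M.edgesOf c
  · rcases hc.eq_or_eq_opp hx hy hxy hz hzc with rfl | rfl
    · rw [left_rot_symm]; exact M.sameSide_refl _ _
    · exact absurd h hn
  · rw [left_rot_symm]
    exact SameSide.trans M h (M.sameSide_left_right hzc)

/-- The unit flow along a simple cycle is conserved at each vertex, hence is a gradient. Its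
potential jumps by one across the cycle and nowhere else, which is what proves Jordan's theorem. -/
theorem exists_potential : ∃ h : M.Face → ℚ, ∀ x, M.grad h x =
    (if x ∈ c then 1 else 0) - (if M.opp x ∈ c then 1 else 0) := by
  obtain ⟨h, hh⟩ := M.exists_grad_eq
    (δ := fun x => (if x ∈ c then 1 else 0) - (if M.opp x ∈ c then 1 else 0))
    (fun x => by simp) (by
      ext v
      rw [divergence_apply, Finset.sum_sub_distrib, Pi.zero_apply, sub_eq_zero]
      have h1 : ∑ x with M.tail x = v, (if x ∈ c then (1 : ℚ) else 0) =
          ∑ u ∈ c.toFinset.image M.tail, if u = v then 1 else 0 := by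
        rw [Finset.sum_image fun x hx y hy h =>
          hc.tail_inj (by simpa using hx) (by simpa using hy) h]
        rw [Finset.sum_filter, ← Finset.sum_filter_add_sum_filter_not Finset.univ (· ∈ c)]
        rw [Finset.sum_eq_zero (s := Finset.univ.filter (· ∉ c)), add_zero]
        · refine Finset.sum_congr (by ext; simp) fun x hx => ?_
          simp [List.mem_toFinset.1 hx]
        · intro x hx
          simp [(Finset.mem_filter.1 hx).2]
      have h2 : ∑ x with M.tail x = v, (if M.opp x ∈ c then (1 : ℚ) else 0) =
          ∑ u ∈ c.toFinset.image M.head, if u = v then 1 else 0 := by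
        rw [Finset.sum_image fun x hx y hy h =>
          hc.head_inj (by simpa using hx) (by simpa using hy) h]
        rw [Finset.sum_filter, ← M.sum_opp,
          ← Finset.sum_filter_add_sum_filter_not Finset.univ (· ∈ c)]
        rw [Finset.sum_eq_zero (s := Finset.univ.filter (· ∉ c)), add_zero]
        · refine Finset.sum_congr (by ext; simp) fun x hx => ?_
          simp [List.mem_toFinset.1 hx]
        · intro x hx
          simp [(Finset.mem_filter.1 hx).2]
      rw [h1, h2, hc.image_tail])
  exact ⟨h, fun x => by rw [hh]⟩

/-- Jordan's theorem: the two sides of a simple cycle are different. -/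
theorem not_sameSide_left_right {x y : D} (hx : x ∈ c) (hy : y ∈ c) :
    ¬ M.SameSide (M.edgesOf c) (M.left x) (M.right y) := by
  intro h
  obtain ⟨p, hp⟩ := hc.exists_potential
  have h0 : ∀ x, M.edge x ∉ M.edgesOf c → M.grad p x = 0 := by
    intro x hx
    rw [edge_mem_edgesOf, not_or] at hx
    simp [hp, hx.1, hx.2]
  have h1 := M.eq_of_sameSide_of_grad h0
    (SameSide.trans M (hc.sameSide_left hy hx) h)
  have h2 := hp y
  rw [grad_apply, if_pos hy, if_neg (hc.opp_notMem hy), h1] at h2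
  norm_num at h2

theorem onLeftSide_or (f : M.Face) : M.OnLeftSide c f ∨
    ∃ x ∈ c, M.SameSide (M.edgesOf c) (M.right x) f := by
  obtain ⟨x₀, hx₀⟩ := List.exists_mem_of_ne_nil c hc.1
  refine M.face_induction (P := fun f => M.OnLeftSide c f ∨
    ∃ x ∈ c, M.SameSide (M.edgesOf c) (M.right x) f) (fun z => ?_)
    (Or.inl ⟨x₀, hx₀, M.sameSide_refl _ _⟩) f
  by_cases hz : M.edge z ∈ M.edgesOf c
  · rcases edge_mem_edgesOf.1 hz with h | h
    · exact iff_of_true (Or.inl ⟨z, h, M.sameSide_refl _ _⟩) (Or.inr ⟨z, h, M.sameSide_refl _ _⟩)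
    · exact iff_of_true (Or.inr ⟨_, h, by simpa using M.sameSide_refl _ _⟩)
        (Or.inl ⟨_, h, by simpa using M.sameSide_refl _ _⟩)
  · have := M.sameSide_left_right hz
    have := M.sameSide_symm this
    constructor
    · rintro (⟨x, hx, h⟩ | ⟨x, hx, h⟩)
      · exact Or.inl ⟨x, hx, SameSide.trans M h ‹_›⟩
      · exact Or.inr ⟨x, hx, SameSide.trans M h ‹_›⟩
    · rintro (⟨x, hx, h⟩ | ⟨x, hx, h⟩)
      · exact Or.inl ⟨x, hx, SameSide.trans M h ‹_›⟩
      · exact Or.inr ⟨x, hx, SameSide.trans M h ‹_›⟩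

/-- A simple cycle has only two sides. -/
theorem sameSide_of_not_sameSide {f g k : M.Face} (hf : ¬ M.SameSide (M.edgesOf c) f k)
    (hg : ¬ M.SameSide (M.edgesOf c) g k) : M.SameSide (M.edgesOf c) f g := by
  have key : ∀ {f g : M.Face} {x y : D} (s : D → M.Face), x ∈ c → y ∈ c →
      (∀ {x y}, x ∈ c → y ∈ c → M.SameSide (M.edgesOf c) (s x) (s y)) →
      M.SameSide (M.edgesOf c) (s x) f → M.SameSide (M.edgesOf c) (s y) g →
      M.SameSide (M.edgesOf c) f g := by
    intro f g x y s hx hy hs h h'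
    exact SameSide.trans M (M.sameSide_symm h) (SameSide.trans M (hs hx hy) h')
  rcases hc.onLeftSide_or f with ⟨x, hx, h1⟩ | ⟨x, hx, h1⟩ <;>
  rcases hc.onLeftSide_or g with ⟨y, hy, h2⟩ | ⟨y, hy, h2⟩
  · exact key M.left hx hy hc.sameSide_left h1 h2
  · rcases hc.onLeftSide_or k with ⟨z, hz, h3⟩ | ⟨z, hz, h3⟩
    · exact absurd (key M.left hx hz hc.sameSide_left h1 h3) hf
    · exact absurd (key M.right hy hz hc.sameSide_right h2 h3) hg
  · rcases hc.onLeftSide_or k with ⟨z, hz, h3⟩ | ⟨z, hz, h3⟩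
    · exact absurd (key M.left hy hz hc.sameSide_left h2 h3) hg
    · exact absurd (key M.right hx hz hc.sameSide_right h1 h3) hf
  · exact key M.right hx hy hc.sameSide_right h1 h2

theorem not_onLeftSide_right {x : D} (hx : x ∈ c) : ¬ M.OnLeftSide c (M.right x) := by
  rintro ⟨y, hy, h⟩
  exact hc.not_sameSide_left_right hy hx h

theorem mem_of_onLeftSide {x : D} (hl : M.OnLeftSide c (M.left x))
    (hr : ¬ M.OnLeftSide c (M.right x)) : x ∈ c := by
  obtain ⟨y, hy, h⟩ := hl
  by_cases hx : M.edge x ∈ M.edgesOf c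
  · rcases edge_mem_edgesOf.1 hx with h' | h'
    · exact h'
    · exact absurd ⟨_, h', M.sameSide_refl _ _⟩ hr
  · exact absurd ⟨y, hy, SameSide.trans M h (M.sameSide_left_right hx)⟩ hr

end IsSimpleCycle

/-- The boundary of a set of faces avoiding `root` contains a simple cycle with `root` on its
right. -/
theorem exists_isSimpleCycle_not_onLeftSide {root : M.Face} {S : Set M.Face} (hne : S.Nonempty)
    (hr : root ∉ S) :
    ∃ c, M.IsSimpleCycle c ∧ (∀ x ∈ c, x ∈ M.boundaryDarts S) ∧ ¬ M.OnLeftSide c root := by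
  induction hn : (Sᶜ).ncard using Nat.strong_induction_on generalizing S with
  | _ n ih =>
  obtain ⟨f, hf⟩ := hne
  obtain ⟨c, hc, hcS⟩ := M.exists_isSimpleCycle_boundaryDarts hf hr
  by_cases hroot : M.OnLeftSide c root
  swap
  · exact ⟨c, hc, hcS, hroot⟩
  -- When `root` is on the left of `c`, fill in the right side of `c`. No new boundary dart appears:
  -- one with its left face newly added would be the reverse of a dart of `c`, so its right face
  -- would already be in `S`.
  set S' := S ∪ {g | ¬ M.OnLeftSide c g}
  obtain ⟨x₀, hx₀⟩ := List.exists_mem_of_ne_nil c hc.1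
  have hlt : (S'ᶜ).ncard < n := by
    rw [← hn]
    refine Set.ncard_lt_ncard ⟨Set.compl_subset_compl.2 Set.subset_union_left, fun h => ?_⟩
      (Set.toFinite _)
    exact h (hcS x₀ hx₀).2 (Or.inr (hc.not_onLeftSide_right hx₀))
  obtain ⟨c', hc', hcS', hroot'⟩ := ih _ hlt (S := S') ⟨f, Or.inl hf⟩
    (by rintro (h | h); exacts [hr h, h hroot]) rfl
  refine ⟨c', hc', fun x hx => ?_, hroot'⟩
  obtain ⟨hl, hr⟩ := hcS' x hx
  have hr1 : M.right x ∉ S := fun h => hr (Or.inl h)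
  have hr2 : M.OnLeftSide c (M.right x) := by
    by_contra h; exact hr (Or.inr h)
  refine ⟨hl.resolve_right fun h => hr1 ?_, hr1⟩
  exact (hcS _ (hc.mem_of_onLeftSide (x := M.opp x) hr2 (by simpa using h))).1

end Cycles

end PlanarMap

/-! ### Counting sides of regions: sparsity from the girth. -/

namespace PlanarMap

section Counting

variable {D : Type*} [Fintype D] (M : PlanarMap D)

theorem card_filter_edge_eq (e : M.Edge) : (Finset.univ.filter fun x => M.edge x = e).card = 2 := by
  obtain ⟨x, rfl⟩ := M.edge_surjective e
  have : (Finset.univ.filter fun y => M.edge y = M.edge x) = {x, M.opp x} := by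
    ext y
    simp only [Finset.mem_filter, Finset.mem_univ, true_and, Finset.mem_insert,
      Finset.mem_singleton]
    rw [eq_comm, edge_eq_edge_iff]
  rw [this, Finset.card_pair (M.opp_ne x).symm]

theorem card_filter_edge_mem (H : Finset M.Edge) :
    (Finset.univ.filter fun x => M.edge x ∈ H).card = 2 * H.card := by
  rw [Finset.card_eq_sum_card_fiberwise (f := M.edge) (t := H) (fun x hx => by simpa using hx),
    Finset.sum_congr rfl (fun e he => ?_), Finset.sum_const, smul_eq_mul, mul_comm]
  rw [Finset.filter_filter, ← M.card_filter_edge_eq e]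
  congr 1
  ext x
  simp only [Finset.mem_filter, Finset.mem_univ, true_and, and_iff_right_iff_imp]
  rintro rfl
  exact he

theorem faceDegree_eq (f : M.Face) :
    M.faceDegree f = (Finset.univ.filter fun x => M.left x = f).card := by
  rw [faceDegree, Nat.card_eq_fintype_card, Fintype.card_subtype]

theorem sum_faceDegree : ∑ f, M.faceDegree f = 2 * Fintype.card M.Edge := by
  have h1 := M.card_filter_edge_mem Finset.univ
  simp only [Finset.mem_univ, Finset.filter_true] at h1
  rw [← Finset.card_univ, ← h1, Finset.card_eq_sum_card_fiberwise (f := M.left) (t := Finset.univ)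
    (fun x _ => by simp)]
  exact Finset.sum_congr rfl fun f _ => M.faceDegree_eq f

/-- The number of sides of edges of `H` bordering the region of `f`. -/
noncomputable def regionDegree (H : Finset M.Edge) (f : M.Face) : ℕ :=
  (Finset.univ.filter fun x => M.edge x ∈ H ∧ M.SameSide (H : Set M.Edge) f (M.left x)).card

variable {M} in
theorem IsSimpleCycle.length_le_card {c : List D} (hc : M.IsSimpleCycle c) {s : Finset D}
    (h : ∀ x ∈ c, x ∈ s) : c.length ≤ s.card := by
  rw [← List.toFinset_card_of_nodup hc.nodup]
  exact Finset.card_le_card fun x hx => h x (by simpa using hx)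

/-- The contour of the region contains a simple cycle. -/
theorem le_regionDegree {d : ℕ} (hd : ∀ c, M.IsSimpleCycle c → d ≤ c.length) {H : Finset M.Edge}
    {f g : M.Face} (h : ¬ M.SameSide (H : Set M.Edge) f g) : d ≤ M.regionDegree H f := by
  obtain ⟨c, hc, hcS⟩ := M.exists_isSimpleCycle_boundaryDarts
    (S := {k | M.SameSide (H : Set M.Edge) f k}) (M.sameSide_refl _ f) h
  refine (hd c hc).trans (hc.length_le_card fun x hx => ?_)
  obtain ⟨h1, h2⟩ := hcS x hx
  simp only [Finset.mem_filter, Finset.mem_univ, true_and]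
  refine ⟨?_, h1⟩
  by_contra hn
  exact h2 (SameSide.trans M h1 (M.sameSide_left_right (by simpa using hn)))

noncomputable instance (C : Set M.Edge) : Fintype (Quotient (M.regionSetoid C)) :=
  Fintype.ofFinite _

theorem sum_regionDegree (H : Finset M.Edge) :
    ∑ s : Quotient (M.regionSetoid (H : Set M.Edge)), M.regionDegree H s.out = 2 * H.card := by
  rw [← M.card_filter_edge_mem, Finset.card_eq_sum_card_fiberwise
    (f := fun x => (Quotient.mk (M.regionSetoid (H : Set M.Edge)) (M.left x))) (t := Finset.univ)
    (fun x _ => by simp)]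
  refine Finset.sum_congr rfl fun s _ => ?_
  rw [Finset.filter_filter, regionDegree]
  congr 1
  ext x
  simp only [Finset.mem_filter, Finset.mem_univ, true_and, and_congr_right_iff]
  intro _
  rw [eq_comm]
  conv_rhs => rw [← s.out_eq]
  exact (Quotient.eq (r := M.regionSetoid (H : Set M.Edge))).symm

theorem regionDegree_congr {H : Finset M.Edge} {f g : M.Face}
    (h : M.SameSide (H : Set M.Edge) f g) : M.regionDegree H f = M.regionDegree H g := by
  unfold regionDegree
  congr 1
  ext x
  simp only [Finset.mem_filter, Finset.mem_univ, true_and, and_congr_right_iff]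
  exact fun _ => ⟨SameSide.trans M (M.sameSide_symm h), SameSide.trans M h⟩

theorem regionDegree_out (H : Finset M.Edge) (f : M.Face) :
    M.regionDegree H (Quotient.mk (M.regionSetoid (H : Set M.Edge)) f).out = M.regionDegree H f :=
  M.regionDegree_congr (Quotient.mk_out (s := M.regionSetoid (H : Set M.Edge)) f)

theorem sparse_of_girth {d : ℕ} (hd : ∀ c, M.IsSimpleCycle c → d ≤ c.length) {H : Finset M.Edge}
    (hH : H.Nonempty) {W : Finset M.Vertex} (hW : ∀ x, M.edge x ∈ H → M.tail x ∈ W) :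
    d * H.card + d ≤ d * W.card + 2 * H.card := by
  have h1 := M.card_add_two_le hH hW (Quotient.mk (M.regionSetoid (H : Set M.Edge)))
    (fun f g h => Quotient.exact h)
  have h2 := M.sum_regionDegree H
  have h3 := Nat.mul_le_mul_left d h1
  rw [mul_add, mul_add] at h3
  -- With a single region there need be no cycle and no lower bound on its degree, but Euler's
  -- inequality alone suffices.
  by_cases hρ : Fintype.card (Quotient (M.regionSetoid (H : Set M.Edge))) ≤ 1
  · have := Nat.mul_le_mul_left d hρ
    omega
  · have h4 : ∑ s : Quotient (M.regionSetoid (H : Set M.Edge)), d ≤ 2 * H.card := by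
      rw [← h2]
      refine Finset.sum_le_sum fun s _ => ?_
      obtain ⟨t, ht⟩ := Fintype.exists_ne_of_one_lt_card (not_le.1 hρ) s
      refine M.le_regionDegree hd (g := t.out) fun h => ht ?_
      rw [← s.out_eq, ← t.out_eq]
      exact (Quotient.sound h).symm
    rw [Finset.sum_const, Finset.card_univ, smul_eq_mul, mul_comm] at h4
    omega

end Counting

end PlanarMap

namespace AnnularAngulation

open PlanarMap

variable {D : Type*} [Fintype D] {p d : ℕ} (A : AnnularAngulation D p d)

theorem card_boundary : (Finset.univ.filter fun x => A.left x = A.boundary).card = p := by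
  rw [← faceDegree_eq, A.boundary_degree]

/-- Otherwise simplicity of the contour would make `facePerm` exchange `x` and `opp x`, and the
boundary face would have degree 2. -/
theorem right_ne_boundary (hp : 3 ≤ p) {x : D} (hx : A.left x = A.boundary) :
    A.right x ≠ A.boundary := by
  intro hx'
  have h1 : A.facePerm x = A.opp x := A.boundary_simple _ _ (by simpa using hx) hx' (by simp)
  have h2 : A.facePerm (A.opp x) = x := A.boundary_simple _ _ (by simpa using hx') hx (by simp)
  have : (Finset.univ.filter fun x => A.left x = A.boundary) ⊆ {x, A.opp x} := by
    intro y hy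
    have := A.left_induction (P := fun z => z = x ∨ z = A.opp x) (x := x) (Or.inl rfl) (by
      rintro z - (rfl | rfl)
      · exact Or.inr h1
      · exact Or.inl h2) (y := y) (by rw [hx]; simpa using hy)
    simpa using this
  have := Finset.card_le_card this
  rw [A.card_boundary, Finset.card_pair (A.opp_ne x).symm] at this
  omega

theorem eq_boundary_of_sameSide {H : Finset A.Edge} (hH : ∀ x, A.left x = A.boundary → A.edge x ∈ H)
    {f : A.Face} (h : A.SameSide (H : Set A.Edge) A.boundary f) : f = A.boundary :=
  SameSide.induction _ h (P := fun f => f = A.boundary)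
    (fun x hx hf => absurd (hH x hf) (by simpa using hx)) rfl

/-- Refines the sparsity count: the region of the boundary face contributes `p` sides and that of
`f` its exact degree, only the other regions being estimated by `d`. -/
theorem sparse_of_boundary {H : Finset A.Edge} (hgirth : ∀ c, A.IsSimpleCycle c → d ≤ c.length)
    (hH : ∀ x, A.left x = A.boundary → A.edge x ∈ H)
    {W : Finset A.Vertex} (hW : ∀ x, A.edge x ∈ H → A.tail x ∈ W)
    {f : A.Face} (hf : f ≠ A.boundary) :
    d * H.card + p + A.regionDegree H f ≤ d * W.card + 2 * H.card := by
  obtain ⟨x₀, hx₀⟩ := A.left_surjective A.boundary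
  have h1 := A.card_add_two_le ⟨_, hH _ hx₀⟩ hW (Quotient.mk (A.regionSetoid (H : Set A.Edge)))
    (fun f g h => Quotient.exact h)
  have h2 := A.sum_regionDegree H
  have h3 := Nat.mul_le_mul_left d h1
  rw [mul_add, mul_add] at h3
  set b := Quotient.mk (A.regionSetoid (H : Set A.Edge)) A.boundary
  set q := Quotient.mk (A.regionSetoid (H : Set A.Edge)) f
  have hbq : q ≠ b := fun h => hf (A.eq_boundary_of_sameSide hH (Quotient.exact h.symm))
  have hp : p ≤ A.regionDegree H A.boundary := by
    refine A.card_boundary.symm.le.trans (Finset.card_le_card fun x hx => ?_)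
    have hx : A.left x = A.boundary := by simpa using hx
    simpa [hH x hx, hx] using A.sameSide_refl _ _
  rw [← Finset.add_sum_erase _ _ (Finset.mem_univ b),
    ← Finset.add_sum_erase _ _ (Finset.mem_erase.2 ⟨hbq, Finset.mem_univ q⟩),
    regionDegree_out, regionDegree_out] at h2
  have h4 : ((Finset.univ.erase b).erase q).card • d ≤
      ∑ s ∈ (Finset.univ.erase b).erase q, A.regionDegree H s.out := by
    refine Finset.card_nsmul_le_sum _ _ _ fun s hs => ?_
    refine A.le_regionDegree hgirth (g := A.boundary) fun h => ?_
    refine (Finset.mem_erase.1 (Finset.mem_erase.1 hs).2).1 ?_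
    rw [← s.out_eq]
    exact Quotient.sound h
  have h5 := Finset.card_erase_add_one (Finset.mem_univ b)
  have h6 := Finset.card_erase_add_one (Finset.mem_erase.2 ⟨hbq, Finset.mem_univ q⟩)
  rw [← Finset.card_univ, ← h5, ← h6] at h3
  simp only [smul_eq_mul, mul_add, mul_one, mul_comm _ d] at h3 h4
  omega

theorem euler_count : d * Fintype.card A.Edge + d + p =
    d * Fintype.card A.Vertex + 2 * Fintype.card A.Edge := by
  have h1 := A.sum_faceDegree
  have h2 := A.euler_card
  rw [← Finset.add_sum_erase _ _ (Finset.mem_univ A.boundary), A.boundary_degree,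
    Finset.sum_congr rfl (fun f hf => A.inner_degree f (Finset.ne_of_mem_erase hf)),
    Finset.sum_const, smul_eq_mul, Finset.card_erase_of_mem (Finset.mem_univ _),
    Finset.card_univ] at h1
  have h3 : 0 < Fintype.card A.Face := Fintype.card_pos_iff.2 ⟨A.boundary⟩
  obtain ⟨k, hk⟩ := Nat.exists_eq_add_of_lt h3
  rw [hk] at h1 h2
  have h4 := congrArg (d * ·) h2
  simp only [mul_add, mul_comm _ d] at h4 h1
  simp at h1 h4
  omega

end AnnularAngulation

/-! ### Existence of a pseudo-orientation by Hall's theorem. -/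

namespace PlanarMap.NBiorientation

variable {D : Type*} {M : PlanarMap D} (O : M.NBiorientation)

theorem mem_ingoing {x : D} : x ∈ O.toBiorientation.ingoing ↔ 0 < O.weight x := Iff.rfl

theorem allowed_iff {x : D} : O.toBiorientation.Allowed x ↔ 0 < O.weight (M.opp x) := by
  rw [Biorientation.Allowed, Biorientation.TwoWay, Biorientation.OneWayAlong, ← or_and_right,
    mem_ingoing]
  tauto

theorem oneWayAlong_iff {x : D} :
    O.toBiorientation.OneWayAlong x ↔ O.weight x = 0 ∧ 0 < O.weight (M.opp x) := by
  rw [Biorientation.OneWayAlong, mem_ingoing, mem_ingoing, not_lt, Nat.le_zero]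

theorem vertexWeight_eq [Fintype D] (v : M.Vertex) :
    O.vertexWeight v = ∑ x with M.tail x = v, O.weight x := by
  unfold vertexWeight
  refine Finset.sum_subset (fun x hx => ?_) (fun x hx hx' => ?_)
  · simp only [Finset.mem_filter, Finset.mem_univ, true_and] at hx ⊢
    exact hx.1
  · simp only [Finset.mem_filter, Finset.mem_univ, true_and, mem_ingoing] at hx hx'
    have : ¬ 0 < O.weight x := fun h => hx' ⟨hx, h⟩
    omega

end PlanarMap.NBiorientation

namespace AnnularAngulation

open PlanarMap

variable {D : Type*} [Fintype D] {p d : ℕ} (A : AnnularAngulation D p d)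

/-- The edges of the boundary face. -/
noncomputable def boundaryEdges : Finset A.Edge :=
  (Finset.univ.filter fun x => A.left x = A.boundary).image A.edge

/-- The vertices of the boundary face. -/
noncomputable def boundaryVertices : Finset A.Vertex :=
  (Finset.univ.filter fun x => A.left x = A.boundary).image A.tail

theorem edge_mem_boundaryEdges {x : D} :
    A.edge x ∈ A.boundaryEdges ↔ A.left x = A.boundary ∨ A.right x = A.boundary := by
  simp only [boundaryEdges, Finset.mem_image, Finset.mem_filter, Finset.mem_univ, true_and]
  constructor
  · rintro ⟨y, hy, h⟩
    rcases A.edge_eq_edge_iff.1 h with rfl | rfl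
    · exact Or.inl hy
    · right; simpa using hy
  · rintro (h | h)
    · exact ⟨x, h, rfl⟩
    · exact ⟨A.opp x, h, by simp⟩

theorem mem_boundaryVertices {v : A.Vertex} :
    v ∈ A.boundaryVertices ↔ A.VertexOnFace A.boundary v := by
  simp [boundaryVertices, VertexOnFace]

theorem card_boundaryEdges (hp : 3 ≤ p) : A.boundaryEdges.card = p := by
  rw [boundaryEdges, Finset.card_image_of_injOn, A.card_boundary]
  intro x hx y hy h
  have hx : A.left x = A.boundary := by simpa using hx
  have hy : A.left y = A.boundary := by simpa using hy
  rcases A.edge_eq_edge_iff.1 h with rfl | rfl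
  · rfl
  · exact absurd hy (A.right_ne_boundary hp hx)

theorem card_boundaryVertices : A.boundaryVertices.card = p := by
  rw [boundaryVertices, Finset.card_image_of_injOn, A.card_boundary]
  intro x hx y hy h
  exact A.boundary_simple x y (by simpa using hx) (by simpa using hy) h

theorem tail_of_edge_mem_boundaryEdges {x : D} (hx : A.edge x ∈ A.boundaryEdges) :
    A.VertexOnFace A.boundary (A.tail x) := by
  rcases A.edge_mem_boundaryEdges.1 hx with h | h
  · exact ⟨x, h, rfl⟩
  · exact ⟨A.facePerm (A.opp x), by simpa using h, by simp⟩

/-- The vertices not incident to the boundary face. -/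
abbrev InnerVertex : Type _ := {v : A.Vertex // ¬ A.VertexOnFace A.boundary v}

/-- The edges not incident to the boundary face. -/
abbrev InnerEdge : Type _ := {e : A.Edge // e ∉ A.boundaryEdges}

theorem card_innerVertex : Fintype.card A.InnerVertex + p = Fintype.card A.Vertex := by
  rw [Fintype.card_subtype]
  have := Finset.card_filter_add_card_filter_not (s := (Finset.univ : Finset A.Vertex))
    (fun v => A.VertexOnFace A.boundary v)
  rw [Finset.card_univ] at this
  rw [← this, add_comm]
  congr 1
  refine A.card_boundaryVertices.symm.trans ?_
  congr 1
  ext v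
  simp [mem_boundaryVertices]

theorem card_innerEdge (hp : 3 ≤ p) : Fintype.card A.InnerEdge + p = Fintype.card A.Edge := by
  have h1 := A.card_boundaryEdges hp
  have h2 : Fintype.card A.InnerEdge = A.boundaryEdgesᶜ.card := by
    rw [Fintype.card_subtype]
    congr 1
    ext e
    simp
  have h3 := Finset.card_compl_add_card A.boundaryEdges
  omega

/-- The slots to which units of edge weight may be assigned: `d` at each inner vertex and `p - d`
shared by the boundary vertices. -/
abbrev Slot : Type _ := (A.InnerVertex × Fin d) ⊕ Fin (p - d)

/-- The slot `a` is available at the vertex `v`. -/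
def SlotAt (v : A.Vertex) : A.Slot → Prop
  | .inl u => u.1.1 = v
  | .inr _ => A.VertexOnFace A.boundary v

/-- Only the set `H` of edges involved matters. If `H` touches the boundary, the shared `p - d`
slots are available, and sparsity of `H` together with the boundary edges gives the bound; otherwise
sparsity of `H` does. -/
theorem hall_condition (hd : 3 ≤ d) (hdp : d ≤ p)
    (hgirth : ∀ c, A.IsSimpleCycle c → d ≤ c.length)
    (s : Finset (A.InnerEdge × Fin (d - 2))) :
    s.card ≤ (s.biUnion fun j =>
      (Finset.univ.filter fun a => ∃ x, A.edge x = j.1.1 ∧ A.SlotAt (A.tail x) a)).card := by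
  rcases s.eq_empty_or_nonempty with rfl | hs
  · simp
  set U := s.biUnion fun j =>
      (Finset.univ.filter fun a => ∃ x, A.edge x = j.1.1 ∧ A.SlotAt (A.tail x) a)
  set H : Finset A.Edge := s.image fun j => j.1.1
  have hHne : H.Nonempty := hs.image _
  have hHB : ∀ e ∈ H, e ∉ A.boundaryEdges := by
    intro e he
    obtain ⟨j, -, rfl⟩ := Finset.mem_image.1 he
    exact j.1.2
  have hsH : s.card ≤ H.card * (d - 2) := by
    have h1 : s ⊆ (s.image Prod.fst) ×ˢ Finset.univ := fun j hj =>
      Finset.mem_product.2 ⟨Finset.mem_image_of_mem _ hj, Finset.mem_univ _⟩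
    have h2 := Finset.card_le_card h1
    rw [Finset.card_product, Finset.card_univ, Fintype.card_fin] at h2
    refine h2.trans (Nat.mul_le_mul_right _ ?_)
    have : H = (s.image Prod.fst).image Subtype.val := by
      rw [Finset.image_image]; rfl
    rw [this, Finset.card_image_of_injective _ Subtype.val_injective]
  set W : Finset A.Vertex := (Finset.univ.filter fun x => A.edge x ∈ H).image A.tail
  have hW : ∀ x, A.edge x ∈ H → A.tail x ∈ W := fun x hx =>
    Finset.mem_image_of_mem _ (by simpa using hx)
  set Wi : Finset A.InnerVertex := Finset.univ.filter fun v => v.1 ∈ W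
  have hmem : ∀ x, A.edge x ∈ H → ∀ a, A.SlotAt (A.tail x) a → a ∈ U := by
    intro x hx a ha
    obtain ⟨j, hj, he⟩ := Finset.mem_image.1 hx
    exact Finset.mem_biUnion.2 ⟨j, hj, by simpa using ⟨x, he.symm, ha⟩⟩
  have hinl : (Wi ×ˢ Finset.univ).map (Function.Embedding.inl : _ ↪ A.Slot) ⊆ U := by
    intro a ha
    obtain ⟨u, hu, rfl⟩ := Finset.mem_map.1 ha
    have hu1 : u.1.1 ∈ W := by simpa [Wi] using hu
    obtain ⟨x, hx, hxu⟩ := Finset.mem_image.1 hu1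
    exact hmem x (by simpa using hx) _ hxu.symm
  have hd2 : d = d - 2 + 2 := by omega
  by_cases htouch : ∃ x, A.edge x ∈ H ∧ A.VertexOnFace A.boundary (A.tail x)
  · obtain ⟨x₀, hx₀, hx₀b⟩ := htouch
    have hinr : (Finset.univ).map (Function.Embedding.inr : _ ↪ A.Slot) ⊆ U := by
      intro a ha
      obtain ⟨u, hu, rfl⟩ := Finset.mem_map.1 ha
      exact hmem x₀ hx₀ _ hx₀b
    have hU : Wi.card * d + (p - d) ≤ U.card := by
      refine le_trans (le_of_eq ?_) (Finset.card_le_card (Finset.union_subset hinl hinr))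
      rw [Finset.card_union_of_disjoint]
      · simp
      · rw [Finset.disjoint_left]
        simp
    have h1 := A.sparse_of_boundary (H := H ∪ A.boundaryEdges) (W := W ∪ A.boundaryVertices)
      (f := A.root) hgirth
      (fun x hx => Finset.mem_union_right _ (A.edge_mem_boundaryEdges.2 (Or.inl hx)))
      (fun x hx => by
        rcases Finset.mem_union.1 hx with hx | hx
        · exact Finset.mem_union_left _ (hW x hx)
        · exact Finset.mem_union_right _
            (A.mem_boundaryVertices.2 (A.tail_of_edge_mem_boundaryEdges hx)))
      A.root_ne
    have h2 : d ≤ A.regionDegree (H ∪ A.boundaryEdges) A.root := by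
      refine A.le_regionDegree hgirth (g := A.boundary) fun h => A.root_ne ?_
      exact A.eq_boundary_of_sameSide
        (fun x hx => Finset.mem_union_right _ (A.edge_mem_boundaryEdges.2 (Or.inl hx)))
        (A.sameSide_symm h)
    have h3 : (H ∪ A.boundaryEdges).card = H.card + p := by
      rw [Finset.card_union_of_disjoint, A.card_boundaryEdges (hd.trans hdp)]
      rw [Finset.disjoint_left]
      exact hHB
    have h4 : (W ∪ A.boundaryVertices).card ≤ Wi.card + p := by
      have : W ∪ A.boundaryVertices ⊆ Wi.image Subtype.val ∪ A.boundaryVertices := by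
        intro v hv
        by_cases hb : v ∈ A.boundaryVertices
        · exact Finset.mem_union_right _ hb
        · have hvW := (Finset.mem_union.1 hv).resolve_right hb
          refine Finset.mem_union_left _ (Finset.mem_image.2
            ⟨⟨v, fun h => hb (A.mem_boundaryVertices.2 h)⟩, by simpa [Wi] using hvW, rfl⟩)
      refine (Finset.card_le_card this).trans ((Finset.card_union_le _ _).trans ?_)
      rw [A.card_boundaryVertices]
      exact Nat.add_le_add_right Finset.card_image_le _
    have h5 := Nat.mul_le_mul_left d h4
    rw [h3] at h1
    simp only [mul_add] at h1 h5
    have h6 : d * H.card = H.card * (d - 2) + 2 * H.card := by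
      rw [mul_comm H.card, ← add_mul, ← hd2]
    rw [mul_comm Wi.card] at hU
    omega
  · push Not at htouch
    have hU : Wi.card * d ≤ U.card := by
      refine le_trans (le_of_eq ?_) (Finset.card_le_card hinl)
      simp
    have h1 := A.sparse_of_girth hgirth hHne hW
    have h4 : W.card ≤ Wi.card := by
      have : W ⊆ Wi.image Subtype.val := by
        intro v hv
        obtain ⟨x, hx, rfl⟩ := Finset.mem_image.1 hv
        exact Finset.mem_image.2 ⟨⟨_, htouch x (by simpa using hx)⟩, by simpa [Wi] using hv, rfl⟩
      exact (Finset.card_le_card this).trans Finset.card_image_le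
    have h5 := Nat.mul_le_mul_left d h4
    have h6 : d * H.card = H.card * (d - 2) + 2 * H.card := by
      rw [mul_comm H.card, ← add_mul, ← hd2]
    rw [mul_comm Wi.card] at hU
    omega

/-- Euler's relation: supply equals demand, so Hall's injection fills every slot and each inner
vertex receives exactly `d`. -/
theorem card_slot (hd : 3 ≤ d) (hdp : d ≤ p) :
    Fintype.card (A.InnerEdge × Fin (d - 2)) = Fintype.card A.Slot := by
  have h1 := A.card_innerEdge (hd.trans hdp)
  have h2 := A.card_innerVertex
  have h3 := A.euler_count
  rw [Fintype.card_prod, Fintype.card_sum, Fintype.card_prod, Fintype.card_fin, Fintype.card_fin,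
    Fintype.card_fin]
  rw [← h1, ← h2] at h3
  obtain ⟨k, rfl⟩ : ∃ k, d = k + 2 := ⟨d - 2, by omega⟩
  obtain ⟨l, rfl⟩ : ∃ l, p = k + 2 + l := ⟨p - (k + 2), by omega⟩
  simp only [Nat.add_sub_cancel, Nat.add_sub_cancel_left]
  nlinarith

theorem exists_isPseudoOrientation (hd : 3 ≤ d) (hdp : d ≤ p)
    (hgirth : ∀ c, A.IsSimpleCycle c → d ≤ c.length) :
    ∃ O : A.NBiorientation, A.IsPseudoOrientation O := by
  obtain ⟨f, hf, hft⟩ := (Finset.all_card_le_biUnion_card_iff_exists_injective _).1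
    (A.hall_condition hd hdp hgirth)
  have hfb : Function.Bijective f :=
    (Fintype.bijective_iff_injective_and_card f).2 ⟨hf, A.card_slot hd hdp⟩
  have hft' : ∀ j, ∃ x, A.edge x = j.1.1 ∧ A.SlotAt (A.tail x) (f j) := fun j => by
    simpa using hft j
  choose g hge hgs using hft'
  have hgB : ∀ j, A.left (g j) ≠ A.boundary ∧ A.right (g j) ≠ A.boundary := fun j => by
    have := j.1.2
    rwa [← hge, edge_mem_boundaryEdges, not_or] at this
  -- `g j` is the half-edge receiving the unit `j`. On a boundary edge the whole weight goes to the
  -- half with the boundary face on its left, which directs the edge with that face on its right.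
  let w : D → ℕ := fun x => (Finset.univ.filter fun j => g j = x).card +
    if A.left x = A.boundary then d - 2 else 0
  have hw0 : ∀ x, A.right x = A.boundary → w x = 0 := by
    intro x hx
    have hx' : A.left x ≠ A.boundary := fun h => A.right_ne_boundary (hd.trans hdp) h hx
    simp only [w, if_neg hx', add_zero, Finset.card_eq_zero, Finset.filter_eq_empty_iff]
    rintro j - rfl
    exact (hgB j).2 hx
  have hw1 : ∀ x, A.left x = A.boundary → w x = d - 2 := by
    intro x hx
    have h0 : (Finset.univ.filter fun j => g j = x) = ∅ := by
      rw [Finset.filter_eq_empty_iff]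
      rintro j - rfl
      exact (hgB j).1 hx
    simp only [w, if_pos hx, h0, Finset.card_empty, zero_add]
  refine ⟨⟨w⟩, fun x => ?_, fun v hv => ?_, fun x hx => ?_⟩
  · change w x + w (A.opp x) = d - 2
    by_cases h1 : A.left x = A.boundary
    · rw [hw1 x h1, hw0 (A.opp x) (by simpa using h1), add_zero]
    by_cases h2 : A.right x = A.boundary
    · rw [hw0 x h2, hw1 (A.opp x) (by simpa using h2), zero_add]
    have hxB : A.edge x ∉ A.boundaryEdges := by
      rw [edge_mem_boundaryEdges, not_or]; exact ⟨h1, h2⟩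
    have h2' : A.left (A.opp x) ≠ A.boundary := h2
    simp only [w, if_neg h1, if_neg h2', add_zero]
    rw [← Finset.card_union_of_disjoint]
    · have : (Finset.univ.filter fun j => g j = x) ∪ (Finset.univ.filter fun j => g j = A.opp x) =
          {⟨A.edge x, hxB⟩} ×ˢ Finset.univ := by
        ext j
        simp only [Finset.mem_union, Finset.mem_filter, Finset.mem_univ, true_and,
          Finset.mem_product, Finset.mem_singleton, and_true]
        rw [← A.edge_eq_edge_iff, hge, Subtype.ext_iff, eq_comm]
      rw [this]
      simp
    · rw [Finset.disjoint_left]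
      simp only [Finset.mem_filter, Finset.mem_univ, true_and]
      rintro j rfl h
      exact A.opp_ne _ h.symm
  · rw [NBiorientation.vertexWeight_eq]
    change ∑ x with A.tail x = v, w x = d
    have h1 : ∑ x with A.tail x = v, w x =
        ∑ x with A.tail x = v, (Finset.univ.filter fun j => g j = x).card := by
      refine Finset.sum_congr rfl fun x hx => ?_
      have hx' : A.left x ≠ A.boundary := fun h =>
        hv ⟨x, h, (Finset.mem_filter.1 hx).2⟩
      simp only [w, if_neg hx', add_zero]
    have h2 : (Finset.univ.filter fun j => A.tail (g j) = v).card =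
        ∑ x with A.tail x = v, (Finset.univ.filter fun j => g j = x).card := by
      rw [Finset.card_eq_sum_card_fiberwise (f := g) (t := Finset.univ.filter fun x => A.tail x = v)
        (fun j hj => by simpa using hj)]
      refine Finset.sum_congr rfl fun x hx => ?_
      rw [Finset.filter_filter]
      congr 1
      ext j
      simp only [Finset.mem_filter, Finset.mem_univ, true_and, and_iff_right_iff_imp]
      rintro rfl
      exact (Finset.mem_filter.1 hx).2
    rw [h1, ← h2]
    -- The units placed at `v` correspond under `f` exactly to the `d` slots of `v`.
    have h3 : (Finset.univ.filter fun j => A.tail (g j) = v).map ⟨f, hf⟩ =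
        (({⟨v, hv⟩} : Finset A.InnerVertex) ×ˢ Finset.univ).map
          (Function.Embedding.inl : _ ↪ A.Slot) := by
      ext a
      obtain ⟨j, rfl⟩ := hfb.2 a
      have hgj := hgs j
      simp only [Finset.mem_map, Finset.mem_filter, Finset.mem_univ, true_and,
        Function.Embedding.coeFn_mk, Finset.mem_product, Finset.mem_singleton, and_true]
      constructor
      · rintro ⟨k, hk, hkj⟩
        obtain rfl := hf hkj
        rcases h : f k with u | u
        · rw [h] at hgj
          exact ⟨u, Subtype.ext (hgj.trans hk), rfl⟩
        · rw [h] at hgj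
          exact absurd (hk ▸ hgj) hv
      · rintro ⟨u, hu, hue⟩
        refine ⟨j, ?_, rfl⟩
        rw [← hue] at hgj
        have : u.1.1 = A.tail (g j) := hgj
        rw [← this, hu]
    have h4 := congrArg Finset.card h3
    rw [Finset.card_map, Finset.card_map] at h4
    rw [h4]
    simp
  · rw [NBiorientation.oneWayAlong_iff]
    change w x = 0 ∧ 0 < w (A.opp x)
    rw [hw0 x hx, hw1 (A.opp x) (by simpa using hx)]
    omega

end AnnularAngulation

/-! ### Existence and uniqueness of the minimal pseudo-orientation. -/

namespace AnnularAngulation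

open PlanarMap

variable {D : Type*} [Fintype D] {p d : ℕ} (A : AnnularAngulation D p d)

theorem left_mem_boundaryEdges {x : D} (hx : A.left x = A.boundary) :
    A.edge x ∈ A.boundaryEdges := A.edge_mem_boundaryEdges.2 (Or.inl hx)

theorem left_ne_boundary {x : D} (hx : A.edge x ∉ A.boundaryEdges) : A.left x ≠ A.boundary :=
  fun h => hx (A.left_mem_boundaryEdges h)

/-- The contour of the region of `f` runs along the boundary face. As that face has a simple
contour, the successor of a contour dart is the adjacent boundary edge, so the region borders all
boundary edges. -/
theorem sameSide_right_of_boundary {f : A.Face} (hf : f ≠ A.boundary) {z : D}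
    (hz : A.left z = A.boundary) :
    A.SameSide (A.boundaryEdges : Set A.Edge) f (A.right z) := by
  set T := {k | A.SameSide (A.boundaryEdges : Set A.Edge) f k}
  have hb : A.boundary ∉ T := fun h =>
    hf (A.eq_boundary_of_sameSide (fun x hx => A.left_mem_boundaryEdges hx) (A.sameSide_symm h))
  have hright : ∀ x ∈ A.boundaryDarts T, A.right x = A.boundary := by
    rintro x ⟨h1, h2⟩
    by_contra hn
    have hx : A.edge x ∉ A.boundaryEdges := by
      rw [edge_mem_boundaryEdges, not_or]
      exact ⟨fun h => hb (h ▸ h1), hn⟩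
    exact h2 (SameSide.trans _ h1 (A.sameSide_left_right (by simpa using hx)))
  obtain ⟨x, hx⟩ := A.exists_mem_boundaryDarts (S := T) (A.sameSide_refl _ f) hb
  refine A.left_induction_symm (P := fun z => A.right z ∈ T) (x := A.opp x)
    (by simpa using hx.1) (fun z hz h => ?_) (hz.trans (hright x hx).symm)
  have hz : A.left z = A.boundary := hz.trans (hright x hx)
  have hzx : A.opp (A.facePerm z) ∈ A.boundaryDarts T := ⟨h, by simpa [hz] using hb⟩
  obtain ⟨y, hy, hyx⟩ := A.exists_succ_mem_boundaryDarts hzx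
  have h1 : A.facePerm z = A.facePerm (A.opp y) :=
    A.boundary_simple _ _ (by simpa using hz) (by simpa using hright y hy) (by
      rw [head_opp] at hyx; simp [hyx])
  have h2 : z = A.opp y := A.facePerm.injective h1
  rw [h2, right_opp]
  exact hy.1

theorem sameSide_of_ne_boundary {f g : A.Face} (hf : f ≠ A.boundary) (hg : g ≠ A.boundary) :
    A.SameSide (A.boundaryEdges : Set A.Edge) f g := by
  obtain ⟨z, hz⟩ := A.left_surjective A.boundary
  exact SameSide.trans _ (A.sameSide_right_of_boundary hf hz)
    (A.sameSide_symm (A.sameSide_right_of_boundary hg hz))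

section Shift

variable {A}

theorem IsPseudoOrientation.weight_of_right {O : A.NBiorientation} (hO : A.IsPseudoOrientation O)
    {x : D} (hx : A.right x = A.boundary) : O.weight x = 0 :=
  (O.oneWayAlong_iff.1 (hO.2.2 x hx)).1

theorem IsPseudoOrientation.weight_of_left {O : A.NBiorientation} (hO : A.IsPseudoOrientation O)
    {x : D} (hx : A.left x = A.boundary) : O.weight x = d - 2 := by
  have h1 := hO.weight_of_right (x := A.opp x) (by simpa using hx)
  have h2 := hO.1 x
  rw [NBiorientation.edgeWeight, h1] at h2
  simpa using h2

/-- The biorientation obtained by transferring weights along the variations of `h`. -/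
noncomputable def shift (O : A.NBiorientation) (h : A.Face → ℤ) : A.NBiorientation where
  weight x := if A.edge x ∈ A.boundaryEdges then O.weight x else
    (O.weight x + h (A.left x) - h (A.right x)).toNat

/-- A gradient is antisymmetric, which preserves edge weights, and divergence-free, which preserves
vertex weights. -/
theorem IsPseudoOrientation.shift {O : A.NBiorientation} (hO : A.IsPseudoOrientation O)
    {h : A.Face → ℤ}
    (hh : ∀ x, A.edge x ∉ A.boundaryEdges → 0 ≤ O.weight x + h (A.left x) - h (A.right x)) :
    A.IsPseudoOrientation (shift O h) := by
  refine ⟨fun x => ?_, fun v hv => ?_, fun x hx => ?_⟩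
  · have h0 := hO.1 x
    unfold NBiorientation.edgeWeight at h0 ⊢
    simp only [AnnularAngulation.shift, edge_opp, left_opp, right_opp]
    split_ifs with hx
    · exact h0
    · have h1 := hh x hx
      have h2 := hh (A.opp x) (by simpa using hx)
      simp only [left_opp, right_opp] at h2
      omega
  · have h0 := hO.2.1 v hv
    rw [NBiorientation.vertexWeight_eq] at h0 ⊢
    zify at h0 ⊢
    have h1 : ∀ x ∈ Finset.univ.filter (fun x => A.tail x = v),
        ((AnnularAngulation.shift O h).weight x : ℤ) =
          O.weight x + (h (A.left x) - h (A.right x)) := by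
      intro x hx
      have hxB : A.edge x ∉ A.boundaryEdges := fun h =>
        hv ((Finset.mem_filter.1 hx).2 ▸ A.tail_of_edge_mem_boundaryEdges h)
      simp only [AnnularAngulation.shift, if_neg hxB, Int.toNat_of_nonneg (hh x hxB)]
      ring
    rw [Finset.sum_congr rfl h1, Finset.sum_add_distrib, h0, Finset.sum_sub_distrib,
      ← A.sum_tail_rot (fun x => h (A.right x))]
    simp
  · have h0 := O.oneWayAlong_iff.1 (hO.2.2 x hx)
    rw [NBiorientation.oneWayAlong_iff]
    have hxB : A.edge x ∈ A.boundaryEdges := A.edge_mem_boundaryEdges.2 (Or.inr hx)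
    simpa [AnnularAngulation.shift, hxB] using h0

/-- Among the admissible integer potentials take one of maximal sum; raising it by one to the left
of a counterclockwise circuit would remain admissible. -/
theorem IsPseudoOrientation.exists_minimal {O : A.NBiorientation} (hO : A.IsPseudoOrientation O) :
    ∃ O' : A.NBiorientation, A.IsMinimalPseudoOrientation O' := by
  -- The value at the root-face removes the additive constant; the value at the boundary face plays
  -- no role on inner edges and is fixed for boundedness.
  let K : Set (A.Face → ℤ) := {h | h A.root = 0 ∧ h A.boundary = 0 ∧
    ∀ x, A.edge x ∉ A.boundaryEdges → 0 ≤ O.weight x + h (A.left x) - h (A.right x)}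
  have hbdd : ∀ f, ∃ N : ℤ, ∀ h ∈ K, h f ≤ N := by
    intro f
    by_cases hf : f = A.boundary
    · exact ⟨0, fun h hh => by rw [hf, hh.2.1]⟩
    -- Crossing an inner dart `x` from left to right raises the potential by at most `O.weight x`.
    · refine SameSide.induction _ (A.sameSide_of_ne_boundary A.root_ne hf)
        (P := fun f => ∃ N : ℤ, ∀ h ∈ K, h f ≤ N) ?_ ⟨0, fun h hh => hh.1.le⟩
      rintro x hx ⟨N, hN⟩
      refine ⟨N + O.weight x, fun h hh => ?_⟩
      have h1 := hN h hh
      have h2 := hh.2.2 x (by simpa using hx)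
      omega
  choose N hN using hbdd
  obtain ⟨m, ⟨h, hK, hm⟩, hmax⟩ := Int.exists_greatest_of_bdd (P := fun m => ∃ h ∈ K, ∑ f, h f = m)
    ⟨∑ f, N f, by rintro _ ⟨h, hh, rfl⟩; exact Finset.sum_le_sum fun f _ => hN f h hh⟩
    ⟨_, 0, ⟨rfl, rfl, fun x _ => by simp⟩, rfl⟩
  have hP := hO.shift hK.2.2
  refine ⟨_, hP, ?_⟩
  rintro c ⟨hc, hca⟩
  by_contra hroot
  simp only [NBiorientation.allowed_iff] at hca
  set S : Set A.Face := {f | A.OnLeftSide c f ∧ f ≠ A.boundary}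
  have hS : ∃ f, f ∈ S := by
    obtain ⟨x, hx⟩ := List.exists_mem_of_ne_nil c hc.1
    refine ⟨A.left x, ⟨x, hx, A.sameSide_refl _ _⟩, fun hxb => ?_⟩
    have := hP.weight_of_right (x := A.opp x) (by simpa using hxb)
    exact (hca x hx).ne' this
  let h' : A.Face → ℤ := fun f => h f + if f ∈ S then 1 else 0
  have hK' : h' ∈ K := by
    refine ⟨?_, ?_, fun x hx => ?_⟩
    · have : A.root ∉ S := fun h => hroot h.1
      simp [h', this, hK.1]
    · have : A.boundary ∉ S := fun h => h.2 rfl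
      simp [h', this, hK.2.1]
    · have h1 := hK.2.2 x hx
      by_cases hr : A.right x ∈ S
      · by_cases hl : A.left x ∈ S
        · simp only [h', hr, hl, if_true]
          omega
        · have hl' : ¬ A.OnLeftSide c (A.left x) := fun h => hl ⟨h, A.left_ne_boundary hx⟩
          have hxc := hc.mem_of_onLeftSide (x := A.opp x) hr.1 (by simpa using hl')
          -- The potential difference drops only on reverses of circuit darts, and these have
          -- positive weight.
          have h2 := hca _ hxc
          simp only [AnnularAngulation.shift, opp_opp_apply, if_neg hx] at h2
          simp only [h', hr, hl, if_true, if_false]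
          omega
      · simp only [h', hr, if_false]
        split_ifs <;> omega
  have h1 := hmax _ ⟨h', hK', rfl⟩
  have h2 : ∑ f, h' f = m + ∑ f, if f ∈ S then 1 else 0 := by
    rw [← hm, ← Finset.sum_add_distrib]
  have h3 : (0 : ℤ) < ∑ f, if f ∈ S then 1 else 0 := by
    obtain ⟨f, hf⟩ := hS
    exact Finset.sum_pos' (fun f _ => by split_ifs <;> simp) ⟨f, Finset.mem_univ _, by simp [hf]⟩
  omega

end Shift

/-- A flow conserved at the inner vertices is a gradient away from the boundary edges. -/
theorem exists_grad_eq_of_inner {δ : D → ℚ} (hδ : ∀ x, δ (A.opp x) = -δ x)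
    (hd : ∀ v, ¬ A.VertexOnFace A.boundary v → A.divergence δ v = 0) :
    ∃ h, ∀ x, A.edge x ∉ A.boundaryEdges → A.grad h x = δ x := by
  let Z : Submodule ℚ (A.Edge → ℚ) :=
    { carrier := {φ | ∀ e, e ∉ A.boundaryEdges → φ e = 0}
      add_mem' := fun {φ ψ} hφ hψ e he => by simp [hφ e he, hψ e he]
      zero_mem' := fun e _ => rfl
      smul_mem' := fun c φ hφ e he => by simp [hφ e he] }
  -- Divergences of flows along the boundary edges: as the contour is connected, they can cancel any
  -- divergence of `δ`, which is supported on the boundary vertices and has total zero.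
  let N := Z.map (A.divergence ∘ₗ A.ofEdge)
  obtain ⟨x₀, hx₀⟩ := A.left_surjective A.boundary
  have hN : ∀ v, A.VertexOnFace A.boundary v →
      (Pi.single v 1 - Pi.single (A.tail x₀) 1 : A.Vertex → ℚ) ∈ N := by
    rintro _ ⟨z, hz, rfl⟩
    refine A.left_induction
      (P := fun z => (Pi.single (A.tail z) 1 - Pi.single (A.tail x₀) 1 : A.Vertex → ℚ) ∈ N)
      (x := x₀) (by simp) (fun z hz h => ?_) (hz.trans hx₀.symm)
    have h1 : (Pi.single (A.tail z) 1 - Pi.single (A.head z) 1 : A.Vertex → ℚ) ∈ N := by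
      rw [← divergence_unitFlow]
      refine ⟨_, fun e he => ?_, rfl⟩
      have : e ≠ A.edge z := by
        rintro rfl
        exact he (A.left_mem_boundaryEdges (hz.trans hx₀))
      rw [unitFlow, Pi.single_eq_of_ne this]
    rw [tail_facePerm]
    simpa using N.sub_mem h h1
  have hmem : A.divergence δ ∈ N := by
    have h1 : A.divergence δ = ∑ v, A.divergence δ v •
        (Pi.single v 1 - Pi.single (A.tail x₀) 1 : A.Vertex → ℚ) := by
      simp only [smul_sub, Finset.sum_sub_distrib]
      rw [← Finset.sum_smul, sum_divergence, A.sum_eq_zero_of_antisymm hδ, zero_smul, sub_zero]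
      ext w
      simp [Finset.sum_apply, Pi.single_apply]
    rw [h1]
    refine N.sum_mem fun v _ => ?_
    by_cases hv : A.VertexOnFace A.boundary v
    · exact N.smul_mem _ (hN v hv)
    · rw [hd v hv, zero_smul]
      exact N.zero_mem
  obtain ⟨φ, hφ, hφd⟩ := hmem
  obtain ⟨h, hh⟩ := A.exists_grad_eq (δ := δ - A.ofEdge φ)
    (fun x => by simp [hδ, ofEdge_opp]; ring)
    (by rw [map_sub, sub_eq_zero]; exact hφd.symm)
  refine ⟨h, fun x hx => ?_⟩
  rw [hh, Pi.sub_apply, ofEdge_apply, hφ _ hx, zero_mul, sub_zero]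

section Unique

variable {A}

/-- A superlevel set of `h` above its value at the root-face has a contour cycle with the root-face
on its right. Where `h` drops across `x`, `O₂` has less weight than `O₁` at `x`, hence positive
weight at `opp x`: the cycle is a counterclockwise circuit of `O₂`. -/
theorem IsMinimalPseudoOrientation.le_root {O₁ O₂ : A.NBiorientation}
    (h₂ : A.IsMinimalPseudoOrientation O₂) {h : A.Face → ℚ}
    (hh : ∀ x, A.edge x ∉ A.boundaryEdges → A.grad h x = O₁.weight x - O₂.weight x)
    (hw : ∀ x, O₁.edgeWeight x = O₂.edgeWeight x) {f : A.Face} (hf : f ≠ A.boundary) :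
    h f ≤ h A.root := by
  by_contra! hlt
  obtain ⟨c, hc, hcS, hcr⟩ := A.exists_isSimpleCycle_not_onLeftSide (root := A.root)
    (S := {g | g ≠ A.boundary ∧ h A.root < h g}) ⟨f, hf, hlt⟩ (fun h => lt_irrefl _ h.2)
  refine hcr (h₂.2 c ⟨hc, fun x hx => ?_⟩)
  obtain ⟨⟨h1, h2⟩, h3⟩ := hcS x hx
  by_cases hr : A.right x = A.boundary
  · exact Or.inr (h₂.1.2.2 x hr)
  · rw [NBiorientation.allowed_iff]
    have h4 : h (A.right x) ≤ h A.root := by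
      by_contra! hn
      exact h3 ⟨hr, hn⟩
    have h5 := hh x (by rw [edge_mem_boundaryEdges, not_or]; exact ⟨h1, hr⟩)
    rw [grad_apply] at h5
    have h6 : (O₂.weight x : ℚ) < O₁.weight x := by linarith
    have h7 := hw x
    unfold NBiorientation.edgeWeight at h7
    have h8 : O₂.weight x < O₁.weight x := by exact_mod_cast h6
    omega

theorem IsMinimalPseudoOrientation.unique {O₁ O₂ : A.NBiorientation}
    (h₁ : A.IsMinimalPseudoOrientation O₁) (h₂ : A.IsMinimalPseudoOrientation O₂) : O₁ = O₂ := by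
  have hw : ∀ x, O₁.edgeWeight x = O₂.edgeWeight x := fun x => (h₁.1.1 x).trans (h₂.1.1 x).symm
  obtain ⟨h, hh⟩ := A.exists_grad_eq_of_inner (δ := fun x => (O₁.weight x : ℚ) - O₂.weight x)
    (fun x => by
      have := hw x
      unfold NBiorientation.edgeWeight at this
      have : (O₁.weight x : ℚ) + O₁.weight (A.opp x) = O₂.weight x + O₂.weight (A.opp x) := by
        exact_mod_cast this
      linarith)
    (fun v hv => by
      have e₁ := h₁.1.2.1 v hv
      have e₂ := h₂.1.2.1 v hv
      rw [NBiorientation.vertexWeight_eq] at e₁ e₂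
      rw [divergence_apply, Finset.sum_sub_distrib, ← Nat.cast_sum, ← Nat.cast_sum, e₁, e₂,
        sub_self])
  have heq : ∀ f, f ≠ A.boundary → h f = h A.root := by
    intro f hf
    -- The reverse inequality exchanges the two orientations and negates the potential.
    refine le_antisymm (h₂.le_root hh hw hf) ?_
    have := h₁.le_root (O₁ := O₂) (h := -h) (fun x hx => by
      rw [map_neg, Pi.neg_apply, hh x hx]; ring) (fun x => (hw x).symm) hf
    simpa using this
  ext x
  by_cases hl : A.left x = A.boundary
  · rw [h₁.1.weight_of_left hl, h₂.1.weight_of_left hl]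
  by_cases hr : A.right x = A.boundary
  · rw [h₁.1.weight_of_right hr, h₂.1.weight_of_right hr]
  have h5 := hh x (by rw [edge_mem_boundaryEdges, not_or]; exact ⟨hl, hr⟩)
  rw [grad_apply, heq _ hl, heq _ hr, sub_self] at h5
  have : (O₁.weight x : ℚ) = O₂.weight x := by linarith
  exact_mod_cast this

end Unique

end AnnularAngulation

/-! ### Separating cycles of length `d` and accessibility. -/

namespace PlanarMap

variable {D : Type*} [Fintype D] {M : PlanarMap D}

theorem IsSimpleCycle.tail_mem_of_edge_mem {c : List D} (hc : M.IsSimpleCycle c) {x : D}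
    (hx : M.edge x ∈ M.edgesOf c) : M.tail x ∈ c.toFinset.image M.tail := by
  rcases edge_mem_edgesOf.1 hx with h | h
  · exact Finset.mem_image_of_mem _ (by simpa using h)
  · rw [hc.image_tail]
    exact Finset.mem_image.2 ⟨M.opp x, by simpa using h, by simp⟩

theorem IsSimpleCycle.not_sameSide_of_edge_mem {c : List D} (hc : M.IsSimpleCycle c) {x : D}
    (hx : M.edge x ∈ M.edgesOf c) : ¬ M.SameSide (M.edgesOf c) (M.left x) (M.right x) := by
  rcases edge_mem_edgesOf.1 hx with h | h
  · exact hc.not_sameSide_left_right h h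
  · intro hs
    exact hc.not_sameSide_left_right h h (by simpa using M.sameSide_symm hs)

theorem IsSimpleCycle.card_image_edge {c : List D} (hc : M.IsSimpleCycle c) :
    (c.toFinset.image M.edge).card = c.length := by
  rw [Finset.card_image_of_injOn, List.toFinset_card_of_nodup hc.nodup]
  intro x hx y hy h
  exact List.inj_on_of_nodup_map hc.2.2.2 (by simpa using hx) (by simpa using hy) h

theorem coe_image_edge (c : List D) : ((c.toFinset.image M.edge : Finset _) : Set M.Edge) =
    M.edgesOf c := by
  ext e
  simp [edgesOf]

theorem sum_filter_edge_mem_opp {α : Type*} [AddCommMonoid α] (H : Finset M.Edge) (g : D → α) :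
    ∑ x with M.edge x ∈ H, g (M.opp x) = ∑ x with M.edge x ∈ H, g x :=
  Finset.sum_equiv M.opp (by simp) (by simp)

end PlanarMap

namespace AnnularAngulation

open PlanarMap

variable {D : Type*} [Fintype D] {p d : ℕ} {A : AnnularAngulation D p d}

section Weights

variable {O : A.NBiorientation} (hO : A.IsPseudoOrientation O)
include hO

theorem IsPseudoOrientation.sum_edge (H : Finset A.Edge) :
    ∑ x with A.edge x ∈ H, O.weight x = (d - 2) * H.card := by
  have h1 : ∑ x with A.edge x ∈ H, (O.weight x + O.weight (A.opp x)) =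
      ∑ x with A.edge x ∈ H, (d - 2) := Finset.sum_congr rfl fun x _ => hO.1 x
  rw [Finset.sum_add_distrib, sum_filter_edge_mem_opp, Finset.sum_const, card_filter_edge_mem,
    smul_eq_mul] at h1
  rw [mul_comm]
  linarith

theorem IsPseudoOrientation.sum_tail {S : Finset A.Vertex}
    (hS : ∀ v ∈ S, ¬ A.VertexOnFace A.boundary v) :
    ∑ x with A.tail x ∈ S, O.weight x = d * S.card := by
  rw [← Finset.sum_fiberwise_of_maps_to (g := A.tail) (t := S) (fun x hx => by simpa using hx),
    Finset.sum_congr rfl (fun v hv => ?_), Finset.sum_const, smul_eq_mul, mul_comm]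
  refine Eq.trans ?_ (hO.2.1 v (hS v hv))
  rw [NBiorientation.vertexWeight_eq, Finset.filter_filter]
  refine Finset.sum_congr ?_ fun _ _ => rfl
  ext x
  simp only [Finset.mem_filter, Finset.mem_univ, true_and, and_iff_right_iff_imp]
  rintro rfl
  exact hv

end Weights

/-- If a cycle of length `d` has the root-face and the boundary face on different sides, then the
edges at its vertices on the side of the root-face are outgoing there. -/
theorem IsPseudoOrientation.weight_eq_zero_of_cycle {O : A.NBiorientation} (hd : 3 ≤ d)
    (hO : A.IsPseudoOrientation O) {c : List D} (hc : A.IsSimpleCycle c) (hcd : c.length = d)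
    (hsep : ¬ A.SameSide (A.edgesOf c) A.root A.boundary) {x : D} (hx : A.edge x ∉ A.edgesOf c)
    (hxr : A.SameSide (A.edgesOf c) A.root (A.left x))
    (hxc : A.tail x ∈ c.toFinset.image A.tail) : O.weight x = 0 := by
  set R : Set A.Face := {f | A.SameSide (A.edgesOf c) A.root f}
  set T := c.toFinset.image A.tail
  have hT : T.card = d := hc.card_image_tail.trans hcd
  set EC := c.toFinset.image A.edge
  have hEC : EC.card = d := hc.card_image_edge.trans hcd
  have hmemEC : ∀ e, e ∈ EC ↔ e ∈ A.edgesOf c := fun e => by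
    rw [← coe_image_edge, Finset.mem_coe]
  have hRR : ∀ x, A.edge x ∉ A.edgesOf c → A.left x ∈ R → A.right x ∈ R := fun x hx h =>
    SameSide.trans _ h (A.sameSide_left_right hx)
  set EI : Finset A.Edge := Finset.univ.filter fun e =>
    e ∉ A.edgesOf c ∧ ∃ x, A.edge x = e ∧ A.left x ∈ R
  have hEI : ∀ x, A.edge x ∈ EI ↔ A.edge x ∉ A.edgesOf c ∧ A.left x ∈ R := by
    intro x
    simp only [EI, Finset.mem_filter, Finset.mem_univ, true_and]
    refine and_congr_right fun hx => ⟨?_, fun h => ⟨x, rfl, h⟩⟩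
    rintro ⟨y, hy, hyR⟩
    rcases A.edge_eq_edge_iff.1 hy with rfl | rfl
    · exact hyR
    · exact hRR y (hy ▸ hx) hyR
  set VI : Finset A.Vertex := Finset.univ.filter fun v =>
    v ∉ T ∧ ∃ x, A.tail x = v ∧ A.edge x ∈ EI
  have hVI : ∀ x, A.tail x ∈ VI → A.edge x ∈ EI := by
    intro x hx
    obtain ⟨hxT, y, hyx, hy⟩ := by
      simpa only [VI, Finset.mem_filter, Finset.mem_univ, true_and] using hx
    have hn : ∀ z, A.tail z = A.tail y → A.edge z ∉ A.edgesOf c := fun z hz h =>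
      hxT (hyx ▸ hz ▸ hc.tail_mem_of_edge_mem h)
    rw [hEI]
    refine ⟨hn x hyx.symm, A.tail_induction (P := fun z => A.left z ∈ R) (x := y)
      ((hEI y).1 hy).2 (fun z hz h => ?_) hyx.symm⟩
    rw [left_rot_symm]
    exact hRR z (hn z hz) h
  have hVIb : ∀ v ∈ VI, ¬ A.VertexOnFace A.boundary v := by
    rintro _ hv ⟨x, hxb, rfl⟩
    have := ((hEI x).1 (hVI x hv)).2
    rw [hxb] at this
    exact hsep this
  have hdisj : Disjoint EI EC := by
    rw [Finset.disjoint_left]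
    intro e he
    rw [hmemEC]
    exact (Finset.mem_filter.1 he).2.1
  -- Euler's inequality for the cycle and the edges `EI` strictly on the root side: the regions are
  -- separated by the faces of `R` and one extra value for the whole other side.
  have h1 := A.card_add_two_le (H := EI ∪ EC) (W := VI ∪ T)
    (by
      obtain ⟨y, hy⟩ := List.exists_mem_of_ne_nil c hc.1
      exact ⟨A.edge y, Finset.mem_union_right _ (Finset.mem_image_of_mem _ (by simpa using hy))⟩)
    (fun x hx => by
      by_cases hxT : A.tail x ∈ T
      · exact Finset.mem_union_right _ hxT
      rcases Finset.mem_union.1 hx with hx | hx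
      · exact Finset.mem_union_left _ (by simpa [VI, hxT] using ⟨x, rfl, hx⟩)
      · exact absurd (hc.tail_mem_of_edge_mem ((hmemEC _).1 hx)) hxT)
    (fun f => if h : f ∈ R then (some ⟨f, h⟩ : Option R) else none)
    (fun f g hfg => by
      by_cases hf : f ∈ R
      · by_cases hg : g ∈ R
        · simp only [dif_pos hf, dif_pos hg, Option.some.injEq, Subtype.mk.injEq] at hfg
          rw [hfg]
          exact A.sameSide_refl _ _
        · simp [hf, hg] at hfg
      · by_cases hg : g ∈ R
        · simp [hf, hg] at hfg
        · have h := hc.sameSide_of_not_sameSide (fun h => hf (A.sameSide_symm h))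
            (fun h => hg (A.sameSide_symm h))
          refine (SameSide.induction _ h (P := fun g => g ∉ R ∧
            A.SameSide ((EI ∪ EC : Finset A.Edge) : Set A.Edge) f g) ?_
            ⟨hf, A.sameSide_refl _ _⟩).2
          rintro z hz ⟨hzR, hfz⟩
          refine ⟨fun h => hzR ?_, SameSide.trans _ hfz (A.sameSide_left_right ?_)⟩
          · simpa using hRR (A.opp z) (by simpa using hz) (by simpa using h)
          · simp only [Finset.coe_union, Set.mem_union, Finset.mem_coe, hmemEC, hEI]
            tauto)
  rw [Finset.card_union_of_disjoint hdisj, hEC, Fintype.card_option] at h1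
  have h2 := Finset.card_union_le VI T
  rw [hT] at h2
  -- Each edge of `EI` has two sides in `R`, each edge of the cycle at most one.
  have h3 : d * Fintype.card R ≤ 2 * EI.card + d := by
    have e1 : (Finset.univ.filter fun x => A.left x ∈ R).card = d * Fintype.card R := by
      have : Fintype.card R = (Finset.univ.filter fun f => f ∈ R).card := Fintype.card_subtype _
      rw [Finset.card_eq_sum_card_fiberwise (f := A.left) (t := Finset.univ.filter fun f => f ∈ R)
        (fun x hx => by simpa using hx), this, mul_comm, ← smul_eq_mul, ← Finset.sum_const]
      refine Finset.sum_congr rfl fun f hf => ?_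
      have hfR : f ∈ R := (Finset.mem_filter.1 hf).2
      refine Eq.trans ?_ (A.inner_degree f (fun h => hsep (h ▸ hfR)))
      rw [faceDegree_eq, Finset.filter_filter]
      congr 1
      ext y
      simp only [Finset.mem_filter, Finset.mem_univ, true_and, and_iff_right_iff_imp]
      rintro rfl
      exact hfR
    have e2 : (Finset.univ.filter fun x => A.left x ∈ R) ⊆
        (Finset.univ.filter fun x => A.edge x ∈ EI) ∪
        (Finset.univ.filter fun x => A.left x ∈ R ∧ A.edge x ∈ A.edgesOf c) := by
      intro y hy
      simp only [Finset.mem_union, Finset.mem_filter, Finset.mem_univ, true_and, hEI] at hy ⊢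
      tauto
    have e3 : (Finset.univ.filter fun x => A.left x ∈ R ∧ A.edge x ∈ A.edgesOf c).card ≤ d := by
      refine le_trans (Finset.card_le_card_of_injOn A.edge (fun y hy => ?_) (fun y hy z hz h => ?_))
        hEC.le
      · exact (hmemEC _).2 (by simpa using hy : _ ∧ _).2
      · simp only [Finset.coe_filter, Finset.mem_univ, true_and, Set.mem_ofPred_eq] at hy hz
        rcases A.edge_eq_edge_iff.1 h with rfl | rfl
        · rfl
        · exact absurd (SameSide.trans _ (A.sameSide_symm hy.1) hz.1)
            (hc.not_sameSide_of_edge_mem hy.2)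
    have e4 := Finset.card_le_card e2
    have e5 := Finset.card_union_le (Finset.univ.filter fun x => A.edge x ∈ EI)
        (Finset.univ.filter fun x => A.left x ∈ R ∧ A.edge x ∈ A.edgesOf c)
    rw [card_filter_edge_mem] at e5
    omega
  have h4 := hO.sum_edge EI
  have h5 := hO.sum_tail hVIb
  have h6 : d * (EI.card + 1) ≤ d * (VI.card + Fintype.card R) :=
    Nat.mul_le_mul_left d (by omega)
  -- The total weight of `EI` is at most what the vertices of `VI` receive, all of it from `EI`, so
  -- nothing is left for half-edges at the cycle.
  have h7 : (d - 2) * EI.card ≤ d * VI.card := by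
    have : (d - 2) * EI.card + 2 * EI.card = d * EI.card := by
      rw [← add_mul]; congr 1; omega
    rw [mul_add, mul_add] at h6
    omega
  have h8 : (Finset.univ.filter fun x => A.tail x ∈ VI) ⊆
      Finset.univ.filter fun x => A.edge x ∈ EI := fun y hy => by
    simpa using hVI y (by simpa using hy)
  have h9 := Finset.sum_sdiff (f := O.weight) h8
  have h10 : ∑ x ∈ (Finset.univ.filter fun x => A.edge x ∈ EI) \
      (Finset.univ.filter fun x => A.tail x ∈ VI), O.weight x = 0 := by omega
  refine Finset.sum_eq_zero_iff.1 h10 x ?_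
  simp only [Finset.mem_sdiff, Finset.mem_filter, Finset.mem_univ, true_and, hEI]
  exact ⟨⟨hx, hxr⟩, fun h => (Finset.mem_filter.1 h).2.1 hxc⟩

/-- No directed path from strictly inside the root side reaches the cycle, so the outer vertex
giving accessibility lies on it. Some root-contour edge then arrives at the cycle without belonging
to it; its weight is zero there, so it is 1-way with the root-face on its right. -/
theorem IsPseudoOrientation.nonSeparated {O : A.NBiorientation} (hd : 3 ≤ d)
    (hO : A.IsPseudoOrientation O) (hB : O.toBiorientation.InClassB A.root) : A.NonSeparated := by
  rintro ⟨c, ⟨hc, hsep, hne⟩, hcd⟩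
  have hsep' : ¬ A.SameSide (A.edgesOf c) A.root A.boundary := fun h => hsep (A.sameSide_symm h)
  have hz : ∀ x, A.edge x ∉ A.edgesOf c → A.SameSide (A.edgesOf c) A.root (A.left x) →
      A.tail x ∈ c.toFinset.image A.tail → O.weight x = 0 := fun x h1 h2 h3 =>
    hO.weight_eq_zero_of_cycle hd hc hcd hsep' h1 h2 h3
  set T := c.toFinset.image A.tail
  have hT : ∀ x, A.edge x ∈ A.edgesOf c → A.tail x ∈ T := fun x => hc.tail_mem_of_edge_mem
  obtain ⟨⟨-, hcw⟩, v, ⟨x₀, hx₀, rfl⟩, hacc⟩ := hB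
  have hvT : A.tail x₀ ∈ T := by
    by_contra hv
    obtain ⟨y, hy⟩ := List.exists_mem_of_ne_nil c hc.1
    have key : ∀ w, O.toBiorientation.Reach (A.tail x₀) w →
        w ∉ T ∧ ∀ x, A.tail x = w → A.SameSide (A.edgesOf c) A.root (A.left x) := by
      have hall : ∀ x, A.tail x ∉ T → A.SameSide (A.edgesOf c) A.root (A.left x) →
          ∀ y, A.tail y = A.tail x → A.SameSide (A.edgesOf c) A.root (A.left y) := by
        intro x hx hxr y hy
        refine A.tail_induction (P := fun z => A.SameSide (A.edgesOf c) A.root (A.left z)) hxr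
          (fun z hz h => ?_) hy
        rw [left_rot_symm]
        exact SameSide.trans _ h (A.sameSide_left_right fun h => hx (hz ▸ hT z h))
      intro w hw
      induction hw with
      | refl => exact ⟨hv, hall x₀ hv (by rw [hx₀]; exact A.sameSide_refl _ _)⟩
      | tail _ hs ih =>
        obtain ⟨x, hxa, rfl, rfl⟩ := hs
        have hxC : A.edge x ∉ A.edgesOf c := fun h => ih.1 (hT x h)
        have hxr : A.SameSide (A.edgesOf c) A.root (A.left (A.opp x)) :=
          SameSide.trans _ (ih.2 x rfl) (A.sameSide_left_right hxC)
        have hhT : A.head x ∉ T := fun h => by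
          have := hz (A.opp x) (by simpa using hxC) hxr h
          rw [NBiorientation.allowed_iff] at hxa
          omega
        exact ⟨hhT, hall (A.opp x) hhT hxr⟩
    exact (key _ (hacc (A.tail y))).1 (Finset.mem_image_of_mem _ (by simpa using hy))
  -- Otherwise, going backwards around the root-face from a vertex of the cycle, all contour edges
  -- lie on the cycle, and the common length `d` makes the two equal.
  obtain ⟨x, hxr, hxT, hxC⟩ : ∃ x, A.left x = A.root ∧ A.head x ∈ T ∧ A.edge x ∉ A.edgesOf c := by
    by_contra! hcon
    have h1 : ∀ x, A.left x = A.root → A.tail x ∈ T := fun x hx =>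
      A.left_induction_symm (P := fun z => A.tail z ∈ T) hvT (fun z hz h =>
        hT z (hcon z (hz.trans hx₀) (by simpa using h))) (hx.trans hx₀.symm)
    have h2 : ∀ x, A.left x = A.root → A.edge x ∈ A.edgesOf c := fun x hx =>
      hcon x hx (by simpa using h1 (A.facePerm x) (by simpa using hx))
    have h3 : (Finset.univ.filter fun x => A.left x = A.root).image A.edge =
        c.toFinset.image A.edge := by
      refine Finset.eq_of_subset_of_card_le (fun e he => ?_) ?_
      · obtain ⟨x, hx, rfl⟩ := Finset.mem_image.1 he
        rw [← Finset.mem_coe, coe_image_edge]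
        exact h2 x (by simpa using hx)
      · rw [hc.card_image_edge, hcd, Finset.card_image_of_injOn, ← faceDegree_eq,
          A.inner_degree _ A.root_ne]
        intro x hx y hy h
        have hx : A.left x = A.root := by simpa using hx
        have hy : A.left y = A.root := by simpa using hy
        rcases A.edge_eq_edge_iff.1 h with rfl | rfl
        · rfl
        · refine absurd ?_ (hc.not_sameSide_of_edge_mem (h2 x hx))
          rw [hx, ← left_opp, hy]
          exact A.sameSide_refl _ _
    refine hne ?_
    rw [← coe_image_edge, ← h3]
    ext e
    simp [contourEdges]
  have hw : O.weight (A.opp x) = 0 := hz (A.opp x) (by simpa using hxC)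
    (by
      have := A.sameSide_left_right hxC
      rwa [hxr] at this) hxT
  rcases hcw x ⟨x, hxr, rfl⟩ with h | ⟨y, hy, hyo, hyr⟩
  · exact h.2.ne' hw
  · rw [NBiorientation.oneWayAlong_iff] at hyo
    rcases A.edge_eq_edge_iff.1 hy with rfl | rfl
    · omega
    · rw [opp_opp_apply] at hw
      have := hO.1 y
      unfold NBiorientation.edgeWeight at this
      exact hyr (by simpa using hxr)

theorem IsPseudoOrientation.accessibleFrom {O : A.NBiorientation} (hd : 3 ≤ d)
    (hgirth : ∀ c, A.IsSimpleCycle c → d ≤ c.length)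
    (hO : A.IsPseudoOrientation O) (hns : A.NonSeparated) {v : A.Vertex}
    (hv : A.VertexOnFace A.root v) : O.toBiorientation.AccessibleFrom v := by
  by_contra hacc
  obtain ⟨u, hu⟩ := not_forall.1 hacc
  set W : Finset A.Vertex := Finset.univ.filter fun w => ¬ O.toBiorientation.Reach v w
  have hmemW : ∀ w, w ∈ W ↔ ¬ O.toBiorientation.Reach v w := fun w => by simp [W]
  have hstep : ∀ x, A.tail x ∉ W → O.toBiorientation.Allowed x → A.head x ∉ W := by
    intro x hx hxa
    rw [hmemW, not_not] at hx ⊢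
    exact hx.tail ⟨x, hxa, rfl, rfl⟩
  set H : Finset A.Edge := Finset.univ.filter fun e => ∀ x, A.edge x = e → A.tail x ∈ W
  have hH : ∀ x, A.edge x ∈ H ↔ A.tail x ∈ W ∧ A.head x ∈ W := by
    intro x
    simp only [H, Finset.mem_filter, Finset.mem_univ, true_and]
    constructor
    · exact fun h => ⟨h x rfl, h (A.opp x) (by simp)⟩
    · rintro ⟨h1, h2⟩ y hy
      rcases A.edge_eq_edge_iff.1 hy.symm with rfl | rfl
      · exact h1
      · exact h2
  -- An ingoing half-edge at an unreachable vertex must come from an unreachable vertex.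
  have hsum : ∑ x with A.tail x ∈ W, O.weight x = (d - 2) * H.card := by
    rw [← hO.sum_edge H]
    refine (Finset.sum_subset (fun x hx => ?_) (fun x hx hx' => ?_)).symm
    · simpa using ((hH x).1 (by simpa using hx)).1
    · simp only [Finset.mem_filter, Finset.mem_univ, true_and, hH, not_and] at hx hx'
      by_contra hw
      refine hstep (A.opp x) (hx' hx) ?_ (by simpa using hx)
      rw [NBiorientation.allowed_iff, opp_opp_apply]
      exact Nat.pos_of_ne_zero hw
  have hd2 : (d - 2) * H.card + 2 * H.card = d * H.card := by
    rw [← add_mul]; congr 1; omega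
  by_cases hWb : ∃ x, A.left x = A.boundary ∧ A.tail x ∈ W
  · obtain ⟨z₀, hz₀, hz₀W⟩ := hWb
    -- The boundary contour is a directed circuit, so all its vertices are unreachable once one is.
    have hbW : ∀ z, A.left z = A.boundary → A.tail z ∈ W := fun z hz =>
      A.left_induction (P := fun z => A.tail z ∈ W) hz₀W (fun z hz hzW => by
        rw [tail_facePerm]
        by_contra hn
        exact hstep (A.opp z) hn (Or.inr (hO.2.2 _ (by simpa using hz.trans hz₀)))
          (by simpa using hzW)) (hz.trans hz₀.symm)
    have hbH : ∀ z, A.left z = A.boundary → A.edge z ∈ H := fun z hz => by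
      rw [hH]
      exact ⟨hbW z hz, by simpa using hbW (A.facePerm z) (by simpa using hz)⟩
    have hsumU := hO.sum_tail (S := Wᶜ) (by
      rintro _ hw ⟨z, hz, rfl⟩
      exact Finset.mem_compl.1 hw (hbW z hz))
    have hall := hO.sum_edge Finset.univ
    have hsplit : ∑ x with A.tail x ∈ W, O.weight x + ∑ x with A.tail x ∈ Wᶜ, O.weight x =
        ∑ x with A.edge x ∈ Finset.univ, O.weight x := by
      simp only [Finset.mem_compl, Finset.mem_univ, Finset.filter_true]
      exact Finset.sum_filter_add_sum_filter_not _ _ _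
    rw [hsum, hsumU, hall, Finset.card_univ] at hsplit
    have heul := A.euler_count
    have hE : (d - 2) * Fintype.card A.Edge + 2 * Fintype.card A.Edge = d * Fintype.card A.Edge := by
      rw [← add_mul]; congr 1; omega
    have hV : d * Wᶜ.card + d * W.card = d * Fintype.card A.Vertex := by
      rw [← mul_add, Finset.card_compl_add_card]
    have hsparse := A.sparse_of_boundary hgirth hbH (fun x hx => ((hH x).1 hx).1) A.root_ne
    -- The complement of `W` contains only inner vertices, so its weight is known too; with Euler's
    -- relation this gives `(d - 2) * |H| = d * |W| - d - p`, and sparsity leaves only `d` sides for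
    -- the region of the root-face.
    have hdeg : A.regionDegree H A.root ≤ d := by omega
    have hrb : ¬ A.SameSide (H : Set A.Edge) A.root A.boundary := fun h =>
      A.root_ne (A.eq_boundary_of_sameSide hbH (A.sameSide_symm h))
    obtain ⟨c, hc, hcS⟩ := A.exists_isSimpleCycle_boundaryDarts
      (S := {k | A.SameSide (H : Set A.Edge) A.root k}) (A.sameSide_refl _ A.root) hrb
    set Q := Finset.univ.filter fun x =>
      A.edge x ∈ H ∧ A.SameSide (H : Set A.Edge) A.root (A.left x)
    have hcQ : c.toFinset ⊆ Q := by
      intro x hx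
      obtain ⟨h1, h2⟩ := hcS x (by simpa using hx)
      simp only [Q, Finset.mem_filter, Finset.mem_univ, true_and]
      refine ⟨?_, h1⟩
      by_contra hn
      exact h2 (SameSide.trans _ h1 (A.sameSide_left_right (by simpa using hn)))
    have hcard := List.toFinset_card_of_nodup hc.nodup
    have hcd := hgirth c hc
    have hle := Finset.card_le_card hcQ
    have hQ : Q.card ≤ d := hdeg
    have heq : c.toFinset = Q := Finset.eq_of_subset_of_card_le hcQ (by omega)
    have hmemc : ∀ x, x ∈ c ↔ x ∈ Q := fun x => by rw [← heq, List.mem_toFinset]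
    refine hns ⟨c, ⟨hc, fun h => hrb ?_, fun h => ?_⟩, by omega⟩
    · refine SameSide.induction _ (A.sameSide_symm h)
        (P := fun f => A.SameSide (H : Set A.Edge) A.root f) (fun x hx hl => ?_)
        (A.sameSide_refl _ _)
      refine SameSide.trans _ hl (A.sameSide_left_right fun hxH => hx ?_)
      exact edge_mem_edgesOf.2 (Or.inl ((hmemc x).2 (by
        simpa [Q] using ⟨hxH, hl⟩)))
    -- If the cycle were the root contour, the starting vertex itself would be unreachable.
    · obtain ⟨x, hx, rfl⟩ := hv
      have hxc : A.edge x ∈ A.edgesOf c := h ▸ ⟨x, hx, rfl⟩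
      have hxH : A.edge x ∈ H := by
        rcases edge_mem_edgesOf.1 hxc with h | h
        · exact (Finset.mem_filter.1 ((hmemc x).1 h)).2.1
        · simpa using (Finset.mem_filter.1 ((hmemc _).1 h)).2.1
      exact (hmemW _).1 ((hH x).1 hxH).1 Relation.ReflTransGen.refl
  · have hsumW := hO.sum_tail (S := W) (by
      rintro _ hw ⟨z, hz, rfl⟩
      exact hWb ⟨z, hz, hw⟩)
    rw [hsum] at hsumW
    have hWpos : 0 < d * W.card :=
      Nat.mul_pos (by omega) (Finset.card_pos.2 ⟨u, (hmemW u).2 hu⟩)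
    have hHne : H.Nonempty := by
      rw [Finset.nonempty_iff_ne_empty]
      rintro h
      rw [h, Finset.card_empty] at hsumW
      omega
    have := A.sparse_of_girth hgirth hHne (fun x hx => ((hH x).1 hx).1)
    omega

/-- The contour of the root-face contains a simple cycle of at least `d` darts, hence consists of
it. -/
theorem right_ne_root (hgirth : ∀ c, A.IsSimpleCycle c → d ≤ c.length) {x : D}
    (hx : A.left x = A.root) : A.right x ≠ A.root := by
  obtain ⟨c, hc, hcS⟩ := A.exists_isSimpleCycle_boundaryDarts (S := {A.root}) (g := A.boundary)
    rfl (fun h => A.root_ne h.symm)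
  have heq : c.toFinset = Finset.univ.filter fun x => A.left x = A.root := by
    refine Finset.eq_of_subset_of_card_le (fun y hy => ?_) ?_
    · simpa using (hcS y (by simpa using hy)).1
    · rw [← faceDegree_eq, A.inner_degree _ A.root_ne, List.toFinset_card_of_nodup hc.nodup]
      exact hgirth c hc
  have hxc : x ∈ c := by
    rw [← List.mem_toFinset, heq]
    simpa using hx
  exact (hcS x hxc).2

end AnnularAngulation

namespace PlanarMap

variable {D : Type*} [Fintype D] {M : PlanarMap D}

/-- A 1-way edge whose origin is reachable from its end lies on a circuit. -/
theorem Biorientation.exists_isCircuit_of_reach {O : M.Biorientation} {y : D}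
    (hy : O.OneWayAlong y) (hr : O.Reach (M.head y) (M.tail y)) : ∃ c, O.IsCircuit c ∧ y ∈ c := by
  -- `N n` consists of the vertices with a directed walk of length `n` to `M.tail y`.
  let N : ℕ → Set M.Vertex := fun n => Nat.rec {M.tail y}
    (fun _ s => {w | ∃ x, O.Allowed x ∧ M.tail x = w ∧ M.head x ∈ s}) n
  have hN : ∃ n, M.head y ∈ N n := by
    generalize M.head y = w at hr
    induction hr using Relation.ReflTransGen.head_induction_on with
    | refl => exact ⟨0, rfl⟩
    | head hs _ ih =>
      obtain ⟨x, hx, h1, h2⟩ := hs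
      obtain ⟨n, hn⟩ := ih
      exact ⟨n + 1, x, hx, h1, h2 ▸ hn⟩
  let dist : M.Vertex → ℕ := fun w => sInf {n | w ∈ N n}
  have hdist : ∀ w n, w ∈ N n → dist w ≤ n := fun w n h => Nat.sInf_le h
  have hyx : ¬ O.Allowed (M.opp y) := by
    rintro (h | h)
    · exact hy.1 (by simpa using h.2)
    · exact hy.1 (by simpa using h.2)
  -- Besides `y`, only darts decreasing the distance to its origin are kept, so a cycle must use
  -- `y`. The condition `∃ n` excludes vertices whose `dist` is the default value 0 of `sInf ∅`.
  obtain ⟨c, hc, hcX⟩ := M.exists_isSimpleCycle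
    (X := {x | x = y ∨ O.Allowed x ∧ (∃ n, M.head x ∈ N n) ∧ dist (M.head x) < dist (M.tail x)})
    ⟨y, Or.inl rfl⟩ (by
      intro x hx
      have hx' : ∃ n, M.head x ∈ N n := by
        rcases hx with rfl | hx
        · exact hN
        · exact hx.2.1
      have hmem : M.head x ∈ N (dist (M.head x)) := Nat.sInf_mem (s := {n | M.head x ∈ N n}) hx'
      rcases hn : dist (M.head x) with _ | m
      · rw [hn] at hmem
        exact ⟨y, Or.inl rfl, (show M.head x = M.tail y from hmem).symm⟩
      · rw [hn] at hmem
        obtain ⟨z, hza, hzt, hzh⟩ := hmem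
        refine ⟨z, Or.inr ⟨hza, ⟨m, hzh⟩, ?_⟩, hzt⟩
        rw [hzt, hn]
        exact Nat.lt_succ_of_le (hdist _ _ hzh)) (by
      rintro x (rfl | ⟨hxa, -, hx⟩) (h | ⟨h1, -, h2⟩)
      · exact M.opp_ne _ h
      · exact hyx h1
      · rw [← h, opp_opp_apply] at hyx
        exact hyx hxa
      · rw [head_opp, tail_opp] at h2
        omega)
  refine ⟨c, ⟨hc, fun x hx => ?_⟩, ?_⟩
  · rcases hcX x hx with rfl | h
    · exact Or.inr hy
    · exact h.1
  · by_contra hyc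
    obtain ⟨x, hx⟩ := List.exists_mem_of_ne_nil c hc.1
    refine lt_irrefl _ (hc.rel_of_succ (r := fun a b => dist (M.tail b) < dist (M.tail a))
      (fun _ _ _ h h' => h'.trans h) (fun a ha b _ hab => ?_) hx hx)
    rcases hcX a ha with rfl | h
    · exact absurd ha hyc
    · rw [← hab]
      exact h.2.2

end PlanarMap

namespace AnnularAngulation

open PlanarMap

variable {D : Type*} [Fintype D] {p d : ℕ} {A : AnnularAngulation D p d}

/-- All outer vertices reach everything, so an outer edge that is 1-way with the root-face on its
right would close up into a circuit having the root-face on its right, against minimality. -/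
theorem IsMinimalPseudoOrientation.inClassB {O : A.NBiorientation} (hd : 3 ≤ d)
    (hgirth : ∀ c, A.IsSimpleCycle c → d ≤ c.length)
    (hO : A.IsMinimalPseudoOrientation O) (hns : A.NonSeparated) :
    O.toBiorientation.InClassB A.root := by
  have hacc : ∀ v, A.VertexOnFace A.root v → O.toBiorientation.AccessibleFrom v := fun v hv =>
    hO.1.accessibleFrom hd hgirth hns hv
  obtain ⟨x₀, hx₀⟩ := A.left_surjective A.root
  refine ⟨⟨hO.2, fun x hx => ?_⟩, _, ⟨x₀, hx₀, rfl⟩, hacc _ ⟨x₀, hx₀, rfl⟩⟩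
  obtain ⟨z, hz, hzx⟩ := hx
  have hnot : ¬ O.toBiorientation.OneWayAlong (A.opp z) := by
    intro h
    obtain ⟨c, hc, hzc⟩ := Biorientation.exists_isCircuit_of_reach h
      (by simpa using hacc (A.tail z) ⟨z, hz, rfl⟩ (A.head z))
    have := hc.1.not_onLeftSide_right hzc
    rw [right_opp, hz] at this
    exact this (hO.2 c hc)
  rw [NBiorientation.oneWayAlong_iff, opp_opp_apply] at hnot
  have hw := hO.1.1 z
  unfold NBiorientation.edgeWeight at hw
  have hopp : 0 < O.weight (A.opp z) := by
    by_contra hn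
    exact hnot ⟨by omega, by omega⟩
  by_cases hz0 : O.weight z = 0
  · exact Or.inr ⟨z, hzx, O.oneWayAlong_iff.2 ⟨hz0, hopp⟩, right_ne_root hgirth hz⟩
  · left
    have hzpos : 0 < O.weight z := Nat.pos_of_ne_zero hz0
    rcases A.edge_eq_edge_iff.1 hzx with rfl | rfl
    · exact ⟨hzpos, hopp⟩
    · exact ⟨hopp, by rw [opp_opp_apply]; exact hzpos⟩

end AnnularAngulation

/-- A `p`-annular `d`-angulation of girth `d` has exactly one minimal pseudo `d/(d-2)`-orientation,
and this orientation is in `𝓑` if and only if the map is non-separated. -/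
theorem proposition5p3 {D : Type*} [Fintype D] (p d : ℕ) (hd : 3 ≤ d) (hdp : d ≤ p)
    (A : AnnularAngulation D p d) (hgirth : A.HasGirth d) :
    (∃! O : A.NBiorientation, A.IsMinimalPseudoOrientation O) ∧
      ∀ O : A.NBiorientation, A.IsMinimalPseudoOrientation O →
        (O.toBiorientation.InClassB A.root ↔ A.NonSeparated) := by
  have hg : ∀ c, A.IsSimpleCycle c → d ≤ c.length := fun c hc => hgirth.2 ⟨c, hc, rfl⟩
  obtain ⟨O, hO⟩ := A.exists_isPseudoOrientation hd hdp hg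
  obtain ⟨O', hO'⟩ := hO.exists_minimal
  exact ⟨⟨O', hO', fun O₂ h => h.unique hO'⟩, fun O₂ h₂ =>
    ⟨fun h => h₂.1.nonSeparated hd h, fun h => h₂.inClassB hd hg h⟩⟩
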